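/- **Setting.** Let $d\ge 1$, let $(\Omega,\mathcal F,\mathbb P)$ be a probability space, and let $(\mathbb R^d,+)$ act on $\Omega$ by measure-preserving bijections $\tau_x$, $x\in\mathbb R^d$, such that $(x,\omega)\mapsto\tau_x\omega$ is jointly measurable (no ergodicity is assumed). For a function $f$ on $\Omega$ write $f_\omega(x):=f(\tau_x\omega)$ for its realisations. $L^p$ means $L^p(\Omega,\mathcal F,\mathbb P)$, $\mathbb E$ is the expectation and $|\cdot|$ the Euclidean norm. A *potential* is a function $0\le V\in L^1$ such that no realisation $V_\omega$ vanishes Lebesgue-almost everywhere. **Derivatives.** If $f_\omega$ is smooth, put $D^nf(\omega):=D^nf_\omega(0)$, and similarly $\nabla f(\omega):=\nabla f_\omega(0)$ and $(\nabla\cdot\phi)(\omega):=(\nabla\cdot\phi_\omega)(0)$. A measurable $g$ is the weak partial derivative $\partial_i f$ of a measurable $f$ if for $\mathbb P$-a.e. $\omega$ the function $g_\omega$ is the $i$-th weak partial derivative of $f_\omega$ on $\mathbb R^d$ (both being locally integrable); it is unique up to null sets and agrees a.s. with the classical derivative where both exist. **Spaces.** Let $y\in\mathbb R^d$. - $\mathbb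 D_{\mathrm w}$: all $f\in L^2$ with weak partial derivatives $\partial_i f\in L^2$ for $i=1,\dots,d$; $\|f\|_\nabla:=\|f\|_2+\sum_i\|\partial_if\|_2$. - $\mathbb D_{\mathrm s}$: all $f\in\mathbb D_{\mathrm w}$ with $f_\omega\in C^\infty(\mathbb R^d)$ for all $\omega$ and $\sup_\Omega|D^nf|<\infty$ for all $n\ge 0$. - $\mathbb F_{\mathrm w}$: all $f\in\mathbb D_{\mathrm w}$ with $\mathbb Ef=1$, $f>c$ a.s. for some $c>0$, and $\|f\|_\infty,\|\nabla f\|_\infty<\infty$. - $\mathbb F_{\mathrm s}$: all $f\in L^1$ with $f_\omega\in C^\infty(\mathbb R^d)$ for all $\omega$, $\sup_\Omega|D^nf|<\infty$ for all $n\ge0$, $\mathbb Ef=1$, and $f\ge c$ on $\Omega$ for some $c>0$. - $\Phi_y^{\mathrm w}$: all $\phi\in(L^2)^d$ with $\mathbb E[\nabla w\cdot\phi]=0$ for all $w\in\mathbb D_{\mathrm s}$ and $\mathbb E\phi=y$. - $\Phi_y^{\mathrm s}$: all $\phi\in(L^1)^d$ with $\phi_\omega\in C^\infty(\mathbb R^d;\mathbb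 R^d)$ and $(\nabla\cdot\phi)(\omega)=0$ for all $\omega$, $\sup_\Omega|D^n\phi|<\infty$ for all $n\ge0$, and $\mathbb E\phi=y$. - $\mathfrak F$: all $\mathbb F\subseteq\mathbb F_{\mathrm w}$ such that for every $f\in\mathbb F_{\mathrm w}$ there are a sequence $(f_n)_n$ in $\mathbb F$ and $c>0$ with $\|f_n-f\|_\nabla\to0$ and $\inf_nf_n>c$ a.s. - $\mathfrak P_y$: all $\Phi_y\subseteq\Phi_y^{\mathrm w}$ that are dense in $\Phi_y^{\mathrm w}$ with respect to $\|\cdot\|_2$. For a set $\mathbb F$ of densities and a set $\Phi$ of vector fields put $$\Gamma_V(\mathbb F,\Phi):=2\inf_{f\in\mathbb F}\left[\left(\int\frac{|\nabla f|^2}{8f}+Vf\,d\mathbb P\right)\left(\inf_{\phi\in\Phi}\int\frac{|\phi|^2}{2f}\,d\mathbb P\right)\right]^{1/2},\qquad \Gamma_V(y):=\Gamma_V(\mathbb F_{\mathrm s},\Phi_y^{\mathrm s}).$$ **Proposition 2.2.** Let $V$ be a potential and $y\in\mathbb R^d$. 1. For every $\Phi_y\in\mathfrak P_y$ one has $\Gamma_V(\mathbb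 F_{\mathrm s},\Phi_y)=\Gamma_V(y)$. 2. If moreover $V\in L^2$, then $\Gamma_V(\mathbb F,\Phi_y)=\Gamma_V(y)$ for every $\mathbb F\in\mathfrak F$ and every $\Phi_y\in\mathfrak P_y$. -/

import Mathlib

open MeasureTheory Filter Topology
open scoped ENNReal

namespace StationaryVar

noncomputable section

/-- `ℝ^d` with the Euclidean norm. -/
abbrev Eucl (d : ℕ) : Type := EuclideanSpace ℝ (Fin d)

/-- The realisation `f_ω : ℝ^d → X`, `x ↦ f (τ_x ω)`, of a function `f` on `Ω`;
the action `τ_x ω` is written `x +ᵥ ω`. -/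
def realisation {d : ℕ} {Ω X : Type*} [AddAction (Eucl d) Ω] (f : Ω → X) (ω : Ω) :
    Eucl d → X :=
  fun x => f (x +ᵥ ω)

/-- A potential: a non-negative function `V ∈ L¹`, no realisation of which vanishes
Lebesgue-almost everywhere. -/
structure IsPotential (d : ℕ) {Ω : Type*} [MeasurableSpace Ω] [AddAction (Eucl d) Ω]
    (μ : Measure Ω) (V : Ω → ℝ) : Prop where
  measurable : Measurable V
  integrable : Integrable V μ
  nonneg : ∀ ω, 0 ≤ V ω
  not_negligible : ∀ ω, ¬ (∀ᵐ x : Eucl d, realisation V ω x = 0)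

/-! ### Classical derivatives on `Ω` -/

/-- All realisations are smooth, and for each `n` the `n`-th derivative
`D^n f (ω) = D^n f_ω (0)` is bounded over all of `Ω`. -/
def SmoothBounded (d : ℕ) {Ω X : Type*} [AddAction (Eucl d) Ω]
    [NormedAddCommGroup X] [NormedSpace ℝ X] (f : Ω → X) : Prop :=
  (∀ ω, ContDiff ℝ (⊤ : ℕ∞) (realisation (d := d) f ω)) ∧
    ∀ n : ℕ, ∃ C : ℝ, ∀ ω, ‖iteratedFDeriv ℝ n (realisation (d := d) f ω) 0‖ ≤ C

/-- The classical gradient `∇f (ω) = ∇f_ω (0)`. -/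
def classicalGrad {d : ℕ} {Ω : Type*} [AddAction (Eucl d) Ω] (f : Ω → ℝ) (ω : Ω) : Eucl d :=
  gradient (realisation f ω) 0

/-- The classical divergence `∇ · φ (ω) = ∑ i, ∂_i φ_{ω,i} (0)`. -/
def divergence {d : ℕ} {Ω : Type*} [AddAction (Eucl d) Ω] (φ : Ω → Eucl d) (ω : Ω) : ℝ :=
  ∑ i, (fderiv ℝ (realisation φ ω) 0 (EuclideanSpace.single i 1)) i

/-! ### Weak derivatives on `Ω` -/

/-- `v` is the `i`-th weak partial derivative of `u` on `ℝ^d`. -/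
def HasWeakPartialEucl {d : ℕ} (i : Fin d) (u v : Eucl d → ℝ) : Prop :=
  LocallyIntegrable u ∧ LocallyIntegrable v ∧
    ∀ ψ : Eucl d → ℝ, ContDiff ℝ (⊤ : ℕ∞) ψ → HasCompactSupport ψ →
      ∫ x, u x * fderiv ℝ ψ x (EuclideanSpace.single i 1) = - ∫ x, v x * ψ x

/-- `g` is an `i`-th weak partial derivative of `f` on `Ω`: almost surely, the realisation `g_ω`
is the `i`-th weak partial derivative of the realisation `f_ω`. -/
def HasWeakPartial {d : ℕ} {Ω : Type*} [MeasurableSpace Ω] [AddAction (Eucl d) Ω]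
    (μ : Measure Ω) (i : Fin d) (f g : Ω → ℝ) : Prop :=
  Measurable g ∧ ∀ᵐ ω ∂μ, HasWeakPartialEucl i (realisation f ω) (realisation g ω)

open Classical in
/-- The weak partial derivative `∂_i f` (a version of it, as it is unique only up to null sets);
`0` if `f` is not weakly differentiable in direction `i`. -/
def weakPartial {d : ℕ} {Ω : Type*} [MeasurableSpace Ω] [AddAction (Eucl d) Ω]
    (μ : Measure Ω) (i : Fin d) (f : Ω → ℝ) : Ω → ℝ :=
  if h : ∃ g, HasWeakPartial μ i f g then h.choose else 0

/-- The weak gradient. -/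
def weakGrad {d : ℕ} {Ω : Type*} [MeasurableSpace Ω] [AddAction (Eucl d) Ω]
    (μ : Measure Ω) (f : Ω → ℝ) (ω : Ω) : Eucl d :=
  WithLp.toLp 2 fun i => weakPartial μ i f ω

/-! ### Function spaces -/

/-- `𝔻_w`: the functions in `L²` with all weak first order partial derivatives in `L²`. -/
def Dw (d : ℕ) {Ω : Type*} [MeasurableSpace Ω] [AddAction (Eucl d) Ω] (μ : Measure Ω) :
    Set (Ω → ℝ) :=
  {f | Measurable f ∧ MemLp f 2 μ ∧
    ∀ i : Fin d, (∃ g, HasWeakPartial μ i f g) ∧ MemLp (weakPartial μ i f) 2 μ}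

/-- The norm `‖f‖_∇ = ‖f‖_2 + ∑ i, ‖∂_i f‖_2` on `𝔻_w`. -/
def nablaNorm (d : ℕ) {Ω : Type*} [MeasurableSpace Ω] [AddAction (Eucl d) Ω] (μ : Measure Ω)
    (f : Ω → ℝ) : ℝ≥0∞ :=
  eLpNorm f 2 μ + ∑ i : Fin d, eLpNorm (weakPartial μ i f) 2 μ

/-- `𝔻_s`: the functions in `𝔻_w` with smooth realisations and bounded derivatives. -/
def Ds (d : ℕ) {Ω : Type*} [MeasurableSpace Ω] [AddAction (Eucl d) Ω] (μ : Measure Ω) :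
    Set (Ω → ℝ) :=
  {f | f ∈ Dw d μ ∧ SmoothBounded d f}

/-- `𝔽_w`: the weakly differentiable probability densities that are bounded, with bounded weak
gradient, and bounded away from zero. -/
def Fw (d : ℕ) {Ω : Type*} [MeasurableSpace Ω] [AddAction (Eucl d) Ω] (μ : Measure Ω) :
    Set (Ω → ℝ) :=
  {f | f ∈ Dw d μ ∧ ∫ ω, f ω ∂μ = 1 ∧ (∃ c : ℝ, 0 < c ∧ ∀ᵐ ω ∂μ, c < f ω) ∧
    MemLp f ⊤ μ ∧ ∀ i : Fin d, MemLp (weakPartial μ i f) ⊤ μ}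

/-- `𝔽_s`: the smooth probability densities bounded away from zero. -/
def Fs (d : ℕ) {Ω : Type*} [MeasurableSpace Ω] [AddAction (Eucl d) Ω] (μ : Measure Ω) :
    Set (Ω → ℝ) :=
  {f | Measurable f ∧ Integrable f μ ∧ SmoothBounded d f ∧ ∫ ω, f ω ∂μ = 1 ∧
    ∃ c : ℝ, 0 < c ∧ ∀ ω, c ≤ f ω}

/-- `Φ_y^w`: the square integrable, weakly divergence-free vector fields with mean `y`. -/
def PhiW {d : ℕ} {Ω : Type*} [MeasurableSpace Ω] [AddAction (Eucl d) Ω] (μ : Measure Ω)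
    (y : Eucl d) : Set (Ω → Eucl d) :=
  {φ | Measurable φ ∧ MemLp φ 2 μ ∧
    (∀ w ∈ Ds d μ, ∫ ω, inner ℝ (classicalGrad w ω) (φ ω) ∂μ = 0) ∧ ∫ ω, φ ω ∂μ = y}

/-- `Φ_y^s`: the smooth divergence-free vector fields with mean `y`. -/
def PhiS {d : ℕ} {Ω : Type*} [MeasurableSpace Ω] [AddAction (Eucl d) Ω] (μ : Measure Ω)
    (y : Eucl d) : Set (Ω → Eucl d) :=
  {φ | Measurable φ ∧ Integrable φ μ ∧ SmoothBounded d φ ∧ ∫ ω, φ ω ∂μ = y ∧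
    ∀ ω, divergence φ ω = 0}

/-- `𝔉`: the subsets of `𝔽_w` from which each `f ∈ 𝔽_w` can be approximated in `‖·‖_∇` by a
sequence that is uniformly bounded away from zero. -/
def AdmissibleF (d : ℕ) {Ω : Type*} [MeasurableSpace Ω] [AddAction (Eucl d) Ω]
    (μ : Measure Ω) : Set (Set (Ω → ℝ)) :=
  {F | F ⊆ Fw d μ ∧ ∀ f ∈ Fw d μ, ∃ (u : ℕ → Ω → ℝ) (c : ℝ), (∀ n, u n ∈ F) ∧ 0 < c ∧
    Tendsto (fun n => nablaNorm d μ (u n - f)) atTop (𝓝 0) ∧ ∀ᵐ ω ∂μ, ∀ n, c < u n ω}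

/-- `𝔓_y`: the subsets of `Φ_y^w` that are dense in it with respect to `‖·‖_2`. -/
def AdmissiblePhi {d : ℕ} {Ω : Type*} [MeasurableSpace Ω] [AddAction (Eucl d) Ω]
    (μ : Measure Ω) (y : Eucl d) : Set (Set (Ω → Eucl d)) :=
  {Φ | Φ ⊆ PhiW μ y ∧
    ∀ φ ∈ PhiW μ y, ∀ ε : ℝ≥0∞, 0 < ε → ∃ ψ ∈ Φ, eLpNorm (ψ - φ) 2 μ < ε}

/-! ### The variational expression -/

/-- `2 inf_{f ∈ F} [ (∫ |∇f|²/(8f) + V f dμ) (inf_{φ ∈ Φ} ∫ |φ|²/(2f) dμ) ]^{1/2}`, where `grad`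
is the gradient operator used for the densities in `F`. -/
def variationalValue {d : ℕ} {Ω : Type*} [MeasurableSpace Ω]
    (μ : Measure Ω) (grad : (Ω → ℝ) → Ω → Eucl d) (V : Ω → ℝ)
    (F : Set (Ω → ℝ)) (Φ : Set (Ω → Eucl d)) : ℝ :=
  2 * ⨅ f : F, Real.sqrt
    ((∫ ω, (‖grad f.1 ω‖ ^ 2 / (8 * f.1 ω) + V ω * f.1 ω) ∂μ) *
      ⨅ φ : Φ, ∫ ω, ‖φ.1 ω‖ ^ 2 / (2 * f.1 ω) ∂μ)

/-- `Γ_V(y)`. -/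
def Gam {d : ℕ} {Ω : Type*} [MeasurableSpace Ω] [AddAction (Eucl d) Ω]
    (μ : Measure Ω) (V : Ω → ℝ) (y : Eucl d) : ℝ :=
  variationalValue μ classicalGrad V (Fs d μ) (PhiS μ y)

end

end StationaryVar

/-! The statement splits into independence of the set of fields and independence of the set of
densities.

Fields. For a fixed density `f ≥ c > 0` the functional `φ ↦ ∫ |φ|²/(2f)` is continuous in `L²`, so
its infimum over any dense subset of `PhiW` is the infimum over `PhiW` (`ciInf_fluxEnergy_eq`). It
remains to see that `PhiS` itself is dense (`PhiS_mem_admissiblePhi`). This is a Helmholtz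
decomposition: a weakly divergence-free `ψ ∈ L²` that is orthogonal to all smooth bounded
divergence-free fields vanishes (`ae_eq_zero_of_orthogonal`). Testing against `∂_j a e_i - ∂_i a
e_j` shows that the mollified `ψ` is curl-free; since it is also divergence-free, its components are
harmonic along orbits. By stationarity `E|∇u|² = -E[u Δu] = 0` for such a component `u`, so `u` is
constant on orbits. Without ergodicity `u` may still depend on the orbit, but `h e_i` is an
admissible test field for every bounded invariant `h`, and this forces `u = 0`. Letting the
mollifier shrink gives `ψ = 0`. A constant field then corrects the mean.

Densities. Along `f_n → f` in `‖·‖_∇` with a common lower bound, the density energy converges; here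
`V ∈ L²` controls `E[V |f_n - f|]` (`tendsto_densityEnergy`). The flux energy converges for each
bounded field (`tendsto_fluxEnergy`), and the fields of `PhiS` are bounded. Hence every admissible
set of densities gives the value of `Fw` (`variationalValue_eq_Fw`), and mollification shows that
`Fs` is admissible (`Fs_mem_admissibleF`).

The first part needs only the argument on fields, applied separately to each `f`, so no
integrability of `V` beyond that of a potential plays a role. -/

set_option linter.unusedSectionVars false

namespace StationaryVar

variable {d : ℕ} {Ω : Type*} [AddAction (Eucl d) Ω]

/-! ### Realisations and null sets -/

lemma realisation_apply {X : Type*} (f : Ω → X) (ω : Ω) (x : Eucl d) :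
    realisation f ω x = f (x +ᵥ ω) := rfl

lemma realisation_vadd {X : Type*} (f : Ω → X) (ω : Ω) (x z : Eucl d) :
    realisation f (z +ᵥ ω) x = realisation f ω (x + z) := by
  simp [realisation, add_vadd]

lemma realisation_zero {X : Type*} (f : Ω → X) (ω : Ω) :
    realisation f ω (0 : Eucl d) = f ω := by
  simp [realisation]

variable [MeasurableSpace Ω]

section

variable [MeasurableVAdd₂ (Eucl d) Ω]

lemma measurable_vadd_prod : Measurable fun p : Ω × Eucl d => p.2 +ᵥ p.1 :=
  measurable_snd.vadd measurable_fst

lemma measurable_neg_vadd_prod : Measurable fun p : Ω × Eucl d => (-p.2) +ᵥ p.1 :=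
  measurable_snd.neg.vadd measurable_fst

lemma measurable_realisation {X : Type*} [MeasurableSpace X] {f : Ω → X} (hf : Measurable f)
    (ω : Ω) : Measurable (realisation (d := d) f ω) :=
  hf.comp (measurable_id.vadd measurable_const)

lemma measurable_comp_vadd {X : Type*} [MeasurableSpace X] {f : Ω → X} (hf : Measurable f)
    (x : Eucl d) : Measurable fun ω => f (x +ᵥ ω) :=
  hf.comp (measurable_const.vadd measurable_id)

variable {μ : Measure Ω} [IsProbabilityMeasure μ] [VAddInvariantMeasure (Eucl d) Ω μ]

lemma measurePreserving_vadd' (x : Eucl d) : MeasurePreserving (fun ω : Ω => x +ᵥ ω) μ μ :=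
  measurePreserving_vadd x μ

lemma lintegral_comp_vadd {F : Ω → ℝ≥0∞} (hF : Measurable F) (x : Eucl d) :
    ∫⁻ ω, F (x +ᵥ ω) ∂μ = ∫⁻ ω, F ω ∂μ :=
  (measurePreserving_vadd' x).lintegral_comp hF

lemma integral_comp_vadd {E : Type*} [NormedAddCommGroup E] [NormedSpace ℝ E] (F : Ω → E)
    (x : Eucl d) : ∫ ω, F (x +ᵥ ω) ∂μ = ∫ ω, F ω ∂μ :=
  (measurePreserving_vadd' x).integral_comp (MeasurableEquiv.vadd x).measurableEmbedding F

/-- Tonelli followed by invariance of `μ`. This is the bridge between Lebesgue measure on orbits and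
`μ`; below, `k` is `1`, the indicator of a ball or the modulus of a mollifier. -/
lemma lintegral_lintegral_vadd {F : Ω → ℝ≥0∞} (hF : Measurable F) {k : Eucl d → ℝ≥0∞}
    (hk : Measurable k) :
    ∫⁻ ω, (∫⁻ x, k x * F (x +ᵥ ω)) ∂μ = (∫⁻ x, k x) * ∫⁻ ω, F ω ∂μ := by
  rw [lintegral_lintegral_swap]
  · rw [← lintegral_mul_const _ hk]
    refine lintegral_congr fun x => ?_
    rw [lintegral_const_mul _ (measurable_comp_vadd hF x), lintegral_comp_vadd hF]
  · exact ((hk.comp measurable_snd).mul (hF.comp measurable_vadd_prod)).aemeasurable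

lemma lintegral_lintegral_neg_vadd {F : Ω → ℝ≥0∞} (hF : Measurable F) {k : Eucl d → ℝ≥0∞}
    (hk : Measurable k) :
    ∫⁻ ω, (∫⁻ x, k x * F ((-x) +ᵥ ω)) ∂μ = (∫⁻ x, k x) * ∫⁻ ω, F ω ∂μ := by
  rw [lintegral_lintegral_swap]
  · rw [← lintegral_mul_const _ hk]
    refine lintegral_congr fun x => ?_
    rw [lintegral_const_mul _ (measurable_comp_vadd hF _), lintegral_comp_vadd hF]
  · exact ((hk.comp measurable_snd).mul (hF.comp measurable_neg_vadd_prod)).aemeasurable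

/-- A property which holds almost surely holds almost surely along almost every translate. -/
lemma ae_ae_vadd {p : Ω → Prop} (hp : ∀ᵐ ω ∂μ, p ω) :
    ∀ᵐ ω ∂μ, ∀ᵐ x : Eucl d, p (x +ᵥ ω) := by
  obtain ⟨N, hN, hNm, hN0⟩ := exists_measurable_superset_of_null (ae_iff.1 hp)
  have h := lintegral_lintegral_vadd (d := d) (μ := μ) (F := N.indicator 1)
    (measurable_one.indicator hNm) (k := 1) measurable_one
  -- With `k = 1` the orbit mass is `∞`; the convention `∞ * 0 = 0` in `ℝ≥0∞` makes the product
  -- vanish.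
  rw [lintegral_indicator_one hNm, hN0, mul_zero] at h
  have hm : Measurable fun p : Ω × Eucl d => (1 : Eucl d → ℝ≥0∞) p.2 *
      N.indicator (1 : Ω → ℝ≥0∞) (p.2 +ᵥ p.1) :=
    measurable_const.mul ((measurable_one.indicator hNm).comp measurable_vadd_prod)
  rw [lintegral_eq_zero_iff hm.lintegral_prod_right'] at h
  filter_upwards [h] with ω hω
  filter_upwards [(lintegral_eq_zero_iff (hm.comp (measurable_prodMk_left (x := ω)))).1 hω]
    with x hx
  by_contra hpx
  have : x +ᵥ ω ∈ N := hN hpx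
  simp [this] at hx

/-- The converse of `ae_ae_vadd` for measurable properties. -/
lemma ae_of_ae_ae_vadd {p : Ω → Prop} (hpm : MeasurableSet {ω | p ω})
    (hp : ∀ᵐ ω ∂μ, ∀ᵐ x : Eucl d, p (x +ᵥ ω)) : ∀ᵐ ω ∂μ, p ω := by
  have h := lintegral_lintegral_vadd (d := d) (μ := μ) (F := {ω | p ω}ᶜ.indicator 1)
    (measurable_one.indicator hpm.compl) (k := 1) measurable_one
  rw [lintegral_indicator_one hpm.compl] at h
  have h0 : ∫⁻ ω, (∫⁻ x : Eucl d, (1 : Eucl d → ℝ≥0∞) x *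
      {ω | p ω}ᶜ.indicator (1 : Ω → ℝ≥0∞) (x +ᵥ ω)) ∂μ = 0 := by
    rw [← lintegral_zero (μ := μ)]
    refine lintegral_congr_ae ?_
    filter_upwards [hp] with ω hω
    rw [← lintegral_zero (μ := (volume : Measure (Eucl d)))]
    refine lintegral_congr_ae ?_
    filter_upwards [hω] with x hx
    simp [hx]
  rw [h0] at h
  have hv : ∫⁻ x : Eucl d, (1 : Eucl d → ℝ≥0∞) x ≠ 0 := by
    simp [NeZero.ne]
  exact (mul_eq_zero.1 h.symm).resolve_left hv

/-! ### Local integrability of realisations -/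

lemma locallyIntegrable_iff_lintegral_ball {u : Eucl d → ℝ} (hu : Measurable u) :
    LocallyIntegrable u ↔ ∀ n : ℕ, ∫⁻ x in Metric.closedBall 0 n, ‖u x‖ₑ < ∞ := by
  constructor
  · intro h n
    exact (h.integrableOn_isCompact (isCompact_closedBall 0 (n : ℝ))).hasFiniteIntegral
  · intro h
    rw [locallyIntegrable_iff]
    intro k hk
    obtain ⟨r, hr⟩ := hk.isBounded.subset_closedBall 0
    obtain ⟨n, hn⟩ := exists_nat_ge r
    have : IntegrableOn u (Metric.closedBall 0 n) := ⟨hu.aestronglyMeasurable, h n⟩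
    exact this.mono_set (hr.trans (Metric.closedBall_subset_closedBall hn))

lemma measurableSet_locallyIntegrable {f : Ω → ℝ} (hf : Measurable f) :
    MeasurableSet {ω | LocallyIntegrable (realisation (d := d) f ω)} := by
  have : {ω | LocallyIntegrable (realisation (d := d) f ω)} =
      ⋂ n : ℕ, {ω | ∫⁻ x in Metric.closedBall (0 : Eucl d) n, ‖f (x +ᵥ ω)‖ₑ < ∞} := by
    ext ω
    simp only [Set.mem_ofPred_eq, Set.mem_iInter,
      locallyIntegrable_iff_lintegral_ball (measurable_realisation hf ω), realisation_apply]
  rw [this]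
  refine MeasurableSet.iInter fun n => ?_
  have hm : Measurable fun p : Ω × Eucl d => ‖f (p.2 +ᵥ p.1)‖ₑ :=
    (hf.comp measurable_vadd_prod).enorm
  exact measurableSet_lt hm.lintegral_prod_right' measurable_const

lemma ae_locallyIntegrable {f : Ω → ℝ} (hf : Measurable f) (hfi : Integrable f μ) :
    ∀ᵐ ω ∂μ, LocallyIntegrable (realisation (d := d) f ω) := by
  have hn : ∀ n : ℕ, ∀ᵐ ω ∂μ, ∫⁻ x in Metric.closedBall (0 : Eucl d) n, ‖f (x +ᵥ ω)‖ₑ < ∞ := by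
    intro n
    have hk : Measurable ((Metric.closedBall (0 : Eucl d) n).indicator (1 : Eucl d → ℝ≥0∞)) :=
      measurable_one.indicator measurableSet_closedBall
    have h := lintegral_lintegral_vadd (μ := μ) hf.enorm hk
    rw [lintegral_indicator_one measurableSet_closedBall] at h
    have hfin : ∫⁻ ω, (∫⁻ x, (Metric.closedBall (0 : Eucl d) n).indicator (1 : Eucl d → ℝ≥0∞) x *
        ‖f (x +ᵥ ω)‖ₑ) ∂μ ≠ ∞ := by
      rw [h]
      exact ENNReal.mul_ne_top measure_closedBall_lt_top.ne hfi.hasFiniteIntegral.ne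
    have hm : Measurable fun p : Ω × Eucl d =>
        (Metric.closedBall (0 : Eucl d) n).indicator (1 : Eucl d → ℝ≥0∞) p.2 *
          ‖f (p.2 +ᵥ p.1)‖ₑ :=
      (hk.comp measurable_snd).mul (hf.comp measurable_vadd_prod).enorm
    filter_upwards [ae_lt_top hm.lintegral_prod_right' hfin] with ω hω
    rw [← lintegral_indicator measurableSet_closedBall]
    refine lt_of_le_of_lt (lintegral_mono fun x => ?_) hω
    by_cases hx : x ∈ Metric.closedBall (0 : Eucl d) n <;> simp [hx]
  filter_upwards [ae_all_iff.2 hn] with ω hω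
  exact (locallyIntegrable_iff_lintegral_ball (measurable_realisation hf ω)).2 hω

/-- Makes the exceptional set of non-integrable orbits invariant, so that a function can be set to
zero on whole orbits without damaging the others. -/
lemma locallyIntegrable_vadd_iff {f : Ω → ℝ} {ω : Ω} (z : Eucl d) :
    LocallyIntegrable (realisation (d := d) f (z +ᵥ ω)) ↔
      LocallyIntegrable (realisation (d := d) f ω) := by
  have key : ∀ (ω : Ω) (z : Eucl d), LocallyIntegrable (realisation (d := d) f ω) →
      LocallyIntegrable (realisation (d := d) f (z +ᵥ ω)) := by
    intro ω z h
    have : realisation (d := d) f (z +ᵥ ω) = realisation f ω ∘ (Homeomorph.addRight z) := by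
      ext x; simp [realisation_vadd]
    rw [this]
    rw [locallyIntegrable_iff]
    intro k hk
    have hmp : MeasurePreserving (Homeomorph.addRight z) (volume : Measure (Eucl d)) volume :=
      measurePreserving_add_right volume z
    have h2 := h.integrableOn_isCompact (hk.image (Homeomorph.addRight z).continuous)
    exact (hmp.integrableOn_image (Homeomorph.addRight z).measurableEmbedding).1 h2
  refine ⟨fun h => ?_, key ω z⟩
  simpa using key _ (-z) h

/-- An integrable function has a version all of whose realisations are locally integrable. -/
lemma exists_locallyIntegrable_version {f : Ω → ℝ} (hf : Measurable f) (hfi : Integrable f μ) :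
    ∃ g : Ω → ℝ, Measurable g ∧ g =ᵐ[μ] f ∧
      ∀ ω, LocallyIntegrable (realisation (d := d) g ω) := by
  set B := {ω | LocallyIntegrable (realisation (d := d) f ω)} with hB
  refine ⟨B.indicator f, hf.indicator (measurableSet_locallyIntegrable hf), ?_, fun ω => ?_⟩
  · filter_upwards [ae_locallyIntegrable (d := d) hf hfi] with ω hω
    exact Set.indicator_of_mem (s := B) hω f
  · by_cases hω : ω ∈ B
    · have : realisation (d := d) (B.indicator f) ω = realisation f ω := by
        ext x
        exact Set.indicator_of_mem (s := B) ((locallyIntegrable_vadd_iff x).2 hω) f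
      rw [this]; exact hω
    · have : realisation (d := d) (B.indicator f) ω = fun _ => 0 := by
        ext x
        exact Set.indicator_of_notMem (s := B)
          (fun h => hω ((locallyIntegrable_vadd_iff x).1 h)) f
      rw [this]; exact locallyIntegrable_const 0

lemma locallyIntegrable_realisation_of_bound {f : Ω → ℝ} (hf : Measurable f) {C : ℝ}
    (hC : ∀ ω, |f ω| ≤ C) (ω : Ω) : LocallyIntegrable (realisation (d := d) f ω) :=
  (locallyIntegrable_const C).mono (measurable_realisation hf ω).aestronglyMeasurable
    (Eventually.of_forall fun _ => (hC _).trans (le_abs_self C))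

end

end StationaryVar

namespace StationaryVar

open scoped Convolution

variable {d : ℕ}

/-! ### Test functions -/

/-- The `j`-th classical partial derivative of a function on `ℝ^d`. -/
noncomputable def pd (j : Fin d) (α : Eucl d → ℝ) : Eucl d → ℝ :=
  fun x => fderiv ℝ α x (EuclideanSpace.single j 1)

/-- Test functions: smooth and compactly supported. -/
structure IsTest (α : Eucl d → ℝ) : Prop where
  contDiff : ContDiff ℝ (⊤ : ℕ∞) α
  hasCompactSupport : HasCompactSupport α

namespace IsTest

variable {α β : Eucl d → ℝ}

lemma continuous (hα : IsTest α) : Continuous α := hα.contDiff.continuous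

lemma integrable (hα : IsTest α) : Integrable α :=
  hα.continuous.integrable_of_hasCompactSupport hα.hasCompactSupport

lemma measurable (hα : IsTest α) : Measurable α := hα.continuous.measurable

lemma contDiff_one (hα : IsTest α) : ContDiff ℝ 1 α := hα.contDiff.of_le (by simp)

lemma pd (hα : IsTest α) (j : Fin d) : IsTest (pd j α) where
  contDiff := (hα.contDiff.fderiv_right (m := (⊤ : ℕ∞)) (by simp)).clm_apply contDiff_const
  hasCompactSupport := hα.hasCompactSupport.fderiv_apply (𝕜 := ℝ) _

lemma comp_neg (hα : IsTest α) : IsTest fun x => α (-x) where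
  contDiff := hα.contDiff.comp contDiff_neg
  hasCompactSupport := hα.hasCompactSupport.comp_homeomorph (Homeomorph.neg (Eucl d))

end IsTest

lemma pd_comp_neg {α : Eucl d → ℝ} (hα : IsTest α) (j : Fin d) (x : Eucl d) :
    pd j (fun x => α (-x)) x = - pd j α (-x) := by
  have h : HasFDerivAt (fun x => α (-x)) ((fderiv ℝ α (-x)).comp
      (-ContinuousLinearMap.id ℝ (Eucl d))) x :=
    (hα.contDiff_one.differentiable one_ne_zero (-x)).hasFDerivAt.comp x (hasFDerivAt_id x).neg
  simp [pd, h.fderiv]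

lemma pd_comm {α : Eucl d → ℝ} (hα : IsTest α) (i j : Fin d) : pd i (pd j α) = pd j (pd i α) := by
  ext x
  have hd : DifferentiableAt ℝ (fderiv ℝ α) x :=
    (hα.contDiff.fderiv_right (m := (⊤ : ℕ∞)) (by simp)).differentiable (by simp) x
  have hs : IsSymmSndFDerivAt ℝ α x :=
    (mod_cast contDiff_infty.1 hα.contDiff 2 : ContDiff ℝ 2 α).contDiffAt.isSymmSndFDerivAt (by simp)
  have key : ∀ i j : Fin d, pd i (pd j α) x =
      fderiv ℝ (fderiv ℝ α) x (EuclideanSpace.single i 1) (EuclideanSpace.single j 1) := by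
    intro i j
    unfold pd
    rw [fderiv_clm_apply hd (differentiableAt_const _)]
    simp
  rw [key, key]
  exact hs _ _

/-! ### Convolution along the action -/

variable {Ω : Type*} [AddAction (Eucl d) Ω]

/-- The mollification of `f` by `α` along the action. -/
noncomputable def mol (α : Eucl d → ℝ) (f : Ω → ℝ) (ω : Ω) : ℝ :=
  ∫ t, α t * f ((-t) +ᵥ ω)

/-- The sign in `(-t) +ᵥ ω` is what turns mollification into an honest convolution on each orbit, so
that Euclidean results on convolutions apply orbit by orbit. -/
lemma realisation_mol (α : Eucl d → ℝ) (f : Ω → ℝ) (ω : Ω) :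
    realisation (mol α f) ω = α ⋆[ContinuousLinearMap.lsmul ℝ ℝ, volume] realisation f ω := by
  ext x
  simp only [realisation, mol, convolution_def, ContinuousLinearMap.lsmul_apply, smul_eq_mul,
    sub_eq_neg_add, add_vadd]

lemma mol_eq_convolution (α : Eucl d → ℝ) (f : Ω → ℝ) (ω : Ω) :
    mol α f ω = (α ⋆[ContinuousLinearMap.lsmul ℝ ℝ, volume] realisation f ω) 0 := by
  rw [← realisation_mol, realisation_zero]

lemma mol_neg (α : Eucl d → ℝ) (f : Ω → ℝ) : mol (fun x => - α x) f = - mol α f := by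
  ext ω
  simp [mol, integral_neg]

lemma convolution_precompL_apply {α : Eucl d → ℝ} (hα : IsTest α) {g : Eucl d → ℝ}
    (hg : LocallyIntegrable g) (x v : Eucl d) :
    (fderiv ℝ α ⋆[(ContinuousLinearMap.lsmul ℝ ℝ).precompL (Eucl d), volume] g) x v =
      ((fun t => fderiv ℝ α t v) ⋆[ContinuousLinearMap.lsmul ℝ ℝ, volume] g) x := by
  have h : ConvolutionExistsAt (fderiv ℝ α) g x
      ((ContinuousLinearMap.lsmul ℝ ℝ).precompL (Eucl d)) volume :=
    (hα.hasCompactSupport.fderiv ℝ).convolutionExists_left _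
      (hα.contDiff_one.continuous_fderiv one_ne_zero) hg x
  rw [convolution_def, convolution_def, ContinuousLinearMap.integral_apply h]
  simp [ContinuousLinearMap.precompL_apply]

lemma hasFDerivAt_realisation_mol {α : Eucl d → ℝ} (hα : IsTest α) {f : Ω → ℝ} {ω : Ω}
    (hf : LocallyIntegrable (realisation (d := d) f ω)) (x : Eucl d) :
    HasFDerivAt (realisation (mol α f) ω)
      ((fderiv ℝ α ⋆[(ContinuousLinearMap.lsmul ℝ ℝ).precompL (Eucl d), volume]
        realisation f ω) x) x := by
  rw [realisation_mol]
  exact hα.hasCompactSupport.hasFDerivAt_convolution_left _ hα.contDiff_one hf x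

lemma contDiff_realisation_mol {α : Eucl d → ℝ} (hα : IsTest α) {f : Ω → ℝ} {ω : Ω}
    (hf : LocallyIntegrable (realisation (d := d) f ω)) :
    ContDiff ℝ (⊤ : ℕ∞) (realisation (d := d) (mol α f) ω) := by
  rw [realisation_mol]
  exact hα.hasCompactSupport.contDiff_convolution_left _ hα.contDiff hf

lemma pd_realisation_mol {α : Eucl d → ℝ} (hα : IsTest α) {f : Ω → ℝ} {ω : Ω}
    (hf : LocallyIntegrable (realisation (d := d) f ω)) (j : Fin d) :
    pd j (realisation (mol α f) ω) = realisation (mol (pd j α) f) ω := by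
  ext x
  rw [pd, (hasFDerivAt_realisation_mol hα hf x).fderiv, convolution_precompL_apply hα hf,
    realisation_mol]
  rfl

lemma clm_eq_sum (L : Eucl d →L[ℝ] ℝ) :
    L = ∑ j, L (EuclideanSpace.single j 1) • (EuclideanSpace.proj j : Eucl d →L[ℝ] ℝ) := by
  ext v
  conv_lhs => rw [← (EuclideanSpace.basisFun (Fin d) ℝ).sum_repr v]
  simp [mul_comm]

lemma fderiv_eq_sum_pd (u : Eucl d → ℝ) :
    fderiv ℝ u = fun x => ∑ j, pd j u x • (EuclideanSpace.proj j : Eucl d →L[ℝ] ℝ) := by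
  ext1 x
  exact clm_eq_sum _

/-- Induction step for bounding all derivatives of a mollification: each `∂_j` of a mollification is
a mollification with another test kernel, so a bound of order `n` for all kernels yields one of
order `n + 1`. -/
lemma norm_iteratedFDeriv_succ_le {u : Eucl d → ℝ} (hu : ContDiff ℝ (⊤ : ℕ∞) u) (n : ℕ)
    {C : ℝ} (x : Eucl d) (h : ∀ j, ‖iteratedFDeriv ℝ n (pd j u) x‖ ≤ C) :
    ‖iteratedFDeriv ℝ (n + 1) u x‖ ≤
      ∑ j, ‖(EuclideanSpace.proj j : Eucl d →L[ℝ] ℝ)‖ * C := by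
  rw [← norm_iteratedFDeriv_fderiv, fderiv_eq_sum_pd]
  have hpd : ∀ j, ContDiff ℝ (⊤ : ℕ∞) (pd j u) := fun j =>
    (hu.fderiv_right (m := (⊤ : ℕ∞)) (by simp)).clm_apply contDiff_const
  have hL : ∀ j : Fin d, (fun x => pd j u x • (EuclideanSpace.proj j : Eucl d →L[ℝ] ℝ)) =
      (ContinuousLinearMap.toSpanSingleton ℝ (EuclideanSpace.proj j : Eucl d →L[ℝ] ℝ)) ∘ pd j u := by
    intro j; ext; simp
  rw [iteratedFDeriv_fun_sum_apply (fun j _ => ?_)]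
  · refine (norm_sum_le _ _).trans (Finset.sum_le_sum fun j _ => ?_)
    rw [hL j, ContinuousLinearMap.iteratedFDeriv_comp_left _ (hpd j).contDiffAt
      (by exact_mod_cast le_top)]
    refine (ContinuousLinearMap.norm_compContinuousMultilinearMap_le _ _).trans ?_
    rw [ContinuousLinearMap.norm_toSpanSingleton]
    exact mul_le_mul_of_nonneg_left (h j) (norm_nonneg _)
  · exact (((hpd j).smul contDiff_const).of_le (by exact_mod_cast le_top)).contDiffAt

variable [MeasurableSpace Ω] [MeasurableVAdd₂ (Eucl d) Ω]

lemma measurable_mol {α : Eucl d → ℝ} (hα : Measurable α) {f : Ω → ℝ} (hf : Measurable f) :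
    Measurable (mol α f) := by
  have : Measurable fun p : Ω × Eucl d => α p.2 * f ((-p.2) +ᵥ p.1) :=
    (hα.comp measurable_snd).mul (hf.comp measurable_neg_vadd_prod)
  exact this.stronglyMeasurable.integral_prod_right'.measurable

lemma abs_mol_le {α : Eucl d → ℝ} (hα : Integrable α) {f : Ω → ℝ}
    {C : ℝ} (hC : ∀ ω, |f ω| ≤ C) (ω : Ω) : |mol α f ω| ≤ (∫ t, |α t|) * C := by
  rw [← integral_mul_const]
  refine norm_integral_le_of_norm_le (f := fun t => α t * f ((-t) +ᵥ ω)) (hα.abs.mul_const C)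
    (Eventually.of_forall fun t => ?_)
  rw [Real.norm_eq_abs, abs_mul]
  exact mul_le_mul_of_nonneg_left (hC _) (abs_nonneg _)

lemma mol_const (α : Eucl d → ℝ) (c : ℝ) : mol α (fun _ : Ω => c) = fun _ => (∫ t, α t) * c := by
  ext ω
  simp [mol, integral_mul_const]

/-- Mollifications of bounded functions are smooth with bounded derivatives. -/
lemma smoothBounded_mol {α : Eucl d → ℝ} (hα : IsTest α) {f : Ω → ℝ} (hf : Measurable f)
    {C : ℝ} (hC : ∀ ω, |f ω| ≤ C) : SmoothBounded d (mol α f) := by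
  have hloc := locallyIntegrable_realisation_of_bound (d := d) hf hC
  refine ⟨fun ω => contDiff_realisation_mol hα (hloc ω), fun n => ?_⟩
  induction n generalizing α with
  | zero =>
    refine ⟨(∫ t, |α t|) * C, fun ω => ?_⟩
    rw [norm_iteratedFDeriv_zero, realisation_zero]
    exact abs_mol_le hα.integrable hC ω
  | succ n ih =>
    choose K hK using fun j => ih (hα.pd j)
    refine ⟨∑ j, ‖(EuclideanSpace.proj j : Eucl d →L[ℝ] ℝ)‖ * ∑ j, |K j|, fun ω => ?_⟩
    refine norm_iteratedFDeriv_succ_le (contDiff_realisation_mol hα (hloc ω)) n 0 fun j => ?_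
    rw [pd_realisation_mol hα (hloc ω)]
    exact ((hK j ω).trans (le_abs_self _)).trans
      (Finset.single_le_sum (f := fun j => |K j|) (fun _ _ => abs_nonneg _) (Finset.mem_univ j))

variable {μ : Measure Ω} [IsProbabilityMeasure μ] [VAddInvariantMeasure (Eucl d) Ω μ]

lemma ae_ae_neg_vadd {p : Ω → Prop} (hp : ∀ᵐ ω ∂μ, p ω) :
    ∀ᵐ ω ∂μ, ∀ᵐ x : Eucl d, p ((-x) +ᵥ ω) := by
  filter_upwards [ae_ae_vadd (d := d) hp] with ω hω
  exact (Measure.measurePreserving_neg (volume : Measure (Eucl d))).quasiMeasurePreserving.ae hω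

/-- A null set meets almost every orbit in a Lebesgue null set, which the integral over `t` does not
see. -/
lemma mol_congr_ae (α : Eucl d → ℝ) {f g : Ω → ℝ} (h : f =ᵐ[μ] g) : mol α f =ᵐ[μ] mol α g := by
  filter_upwards [ae_ae_neg_vadd (d := d) h] with ω hω
  refine integral_congr_ae ?_
  filter_upwards [hω] with t ht
  rw [ht]

lemma integrable_kernel_mul {α : Eucl d → ℝ} (hα : Integrable α) (hαm : Measurable α) {f : Ω → ℝ}
    (hfm : Measurable f) (hf : Integrable f μ) :
    Integrable (fun p : Ω × Eucl d => α p.2 * f ((-p.2) +ᵥ p.1)) (μ.prod volume) := by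
  have hm : Measurable fun p : Ω × Eucl d => α p.2 * f ((-p.2) +ᵥ p.1) :=
    (hαm.comp measurable_snd).mul (hfm.comp measurable_neg_vadd_prod)
  refine ⟨hm.aestronglyMeasurable, ?_⟩
  rw [hasFiniteIntegral_iff_enorm, lintegral_prod _ hm.enorm.aemeasurable]
  simp only [enorm_mul]
  rw [lintegral_lintegral_neg_vadd hfm.enorm hαm.enorm]
  exact ENNReal.mul_lt_top hα.hasFiniteIntegral hf.hasFiniteIntegral

lemma integrable_kernel_mul_mul {α : Eucl d → ℝ} (hα : Integrable α) (hαm : Measurable α)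
    {f g : Ω → ℝ} (hfm : Measurable f) (hf : MemLp f 2 μ) (hgm : Measurable g)
    (hg : MemLp g 2 μ) :
    Integrable (fun p : Ω × Eucl d => α p.2 * f ((-p.2) +ᵥ p.1) * g p.1) (μ.prod volume) := by
  have h1 := integrable_kernel_mul hα.abs hαm.abs (hfm.pow_const 2) hf.integrable_sq
  have h2 : Integrable (fun p : Ω × Eucl d => g p.1 ^ 2 * |α p.2|) (μ.prod volume) :=
    hg.integrable_sq.mul_prod hα.abs
  refine (h1.add h2).mono' ?_ (Eventually.of_forall fun p => ?_)
  · exact (((hαm.comp measurable_snd).mul (hfm.comp measurable_neg_vadd_prod)).mul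
      (hgm.comp measurable_fst)).aestronglyMeasurable
  · simp only [Pi.add_apply, Real.norm_eq_abs, abs_mul]
    have h3 : |f ((-p.2) +ᵥ p.1)| * |g p.1| ≤ f ((-p.2) +ᵥ p.1) ^ 2 + g p.1 ^ 2 := by
      rw [← sq_abs (f _), ← sq_abs (g _)]
      nlinarith [sq_nonneg (|f ((-p.2) +ᵥ p.1)| - |g p.1|), sq_nonneg (|f ((-p.2) +ᵥ p.1)|),
        sq_nonneg (|g p.1|)]
    calc _ = |α p.2| * (|f ((-p.2) +ᵥ p.1)| * |g p.1|) := by ring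
      _ ≤ |α p.2| * (f ((-p.2) +ᵥ p.1) ^ 2 + g p.1 ^ 2) :=
        mul_le_mul_of_nonneg_left h3 (abs_nonneg _)
      _ = _ := by ring

/-- The adjoint of the mollification by `α` is the mollification by `x ↦ α (-x)`. -/
lemma integral_mol_mul {α : Eucl d → ℝ} (hα : IsTest α)
    {f g : Ω → ℝ} (hfm : Measurable f) (hf : MemLp f 2 μ) (hgm : Measurable g)
    (hg : MemLp g 2 μ) :
    ∫ ω, mol α f ω * g ω ∂μ = ∫ ω, f ω * mol (fun x => α (-x)) g ω ∂μ := by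
  calc ∫ ω, mol α f ω * g ω ∂μ
      = ∫ ω, (∫ t, α t * f ((-t) +ᵥ ω) * g ω) ∂μ := by
        simp only [mol, integral_mul_const]
    _ = ∫ t, ∫ ω, α t * f ((-t) +ᵥ ω) * g ω ∂μ :=
        integral_integral_swap (integrable_kernel_mul_mul hα.integrable hα.measurable hfm hf hgm hg)
    _ = ∫ t, ∫ ω, α (-t) * f (t +ᵥ ω) * g ω ∂μ := by
        rw [← integral_neg_eq_self]
        simp
    _ = ∫ t, ∫ ω, α (-t) * g ((-t) +ᵥ ω) * f ω ∂μ := by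
        refine integral_congr_ae (Eventually.of_forall fun t => ?_)
        dsimp only
        -- Shifting `ω` by `-t` moves the translation from `f` to `g`.
        rw [← integral_comp_vadd _ (-t)]
        refine integral_congr_ae (Eventually.of_forall fun ω => ?_)
        simp only [vadd_neg_vadd]
        ring
    _ = ∫ ω, (∫ t, α (-t) * g ((-t) +ᵥ ω) * f ω) ∂μ :=
        (integral_integral_swap (integrable_kernel_mul_mul hα.comp_neg.integrable
          hα.comp_neg.measurable hgm hg hfm hf)).symm
    _ = _ := by
        simp only [mol, integral_mul_const]
        simp only [mul_comm]

lemma integral_mol {α : Eucl d → ℝ} (hα : IsTest α) {f : Ω → ℝ} (hfm : Measurable f)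
    (hf : MemLp f 2 μ) : ∫ ω, mol α f ω ∂μ = (∫ t, α t) * ∫ ω, f ω ∂μ := by
  have h := integral_mol_mul hα hfm hf (measurable_const (a := (1 : ℝ))) (memLp_const 1)
  rw [mol_const, integral_neg_eq_self] at h
  simpa [integral_mul_const, mul_comm] using h

/-- Cauchy-Schwarz for the measure `|α(t)| dt`, after splitting `|α| = |α|^{1/2} |α|^{1/2}`, bounds
the squared mollification by `‖α‖₁ ∫ |α(t)| |f(-t + ω)|² dt`. By invariance this has mean `‖α‖₁²
‖f‖₂²`. -/
lemma memLp_mol {α : Eucl d → ℝ} (hα : IsTest α) {f : Ω → ℝ} (hfm : Measurable f)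
    (hf : MemLp f 2 μ) : MemLp (mol α f) 2 μ := by
  refine ⟨(measurable_mol hα.measurable hfm).aestronglyMeasurable, ?_⟩
  rw [eLpNorm_lt_top_iff_lintegral_rpow_enorm_lt_top two_ne_zero ENNReal.ofNat_ne_top]
  have hf2 := (eLpNorm_lt_top_iff_lintegral_rpow_enorm_lt_top two_ne_zero
    ENNReal.ofNat_ne_top).1 hf.2
  simp only [ENNReal.toReal_ofNat] at hf2 ⊢
  set A := ∫⁻ t, ‖α t‖ₑ with hA
  have hpt : ∀ ω, ‖mol α f ω‖ₑ ^ (2 : ℝ) ≤ A * ∫⁻ t, ‖α t‖ₑ * ‖f ((-t) +ᵥ ω)‖ₑ ^ (2 : ℝ) := by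
    intro ω
    have h1 : ‖mol α f ω‖ₑ ≤ ∫⁻ t, ‖α t‖ₑ * ‖f ((-t) +ᵥ ω)‖ₑ := by
      refine (enorm_integral_le_lintegral_enorm _).trans_eq ?_
      simp only [enorm_mul]
    have hfω : Measurable fun t : Eucl d => f ((-t) +ᵥ ω) :=
      hfm.comp (measurable_id.neg.vadd measurable_const)
    have h2 := ENNReal.lintegral_mul_le_Lp_mul_Lq (volume : Measure (Eucl d))
      Real.HolderConjugate.two_two (f := fun t => ‖α t‖ₑ ^ (1 / 2 : ℝ))
      (g := fun t => ‖α t‖ₑ ^ (1 / 2 : ℝ) * ‖f ((-t) +ᵥ ω)‖ₑ)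
      (hα.measurable.enorm.pow_const _).aemeasurable
      ((hα.measurable.enorm.pow_const _).mul hfω.enorm).aemeasurable
    have h3 : ∀ t, ((fun t => ‖α t‖ₑ ^ (1 / 2 : ℝ)) *
        fun t => ‖α t‖ₑ ^ (1 / 2 : ℝ) * ‖f ((-t) +ᵥ ω)‖ₑ) t = ‖α t‖ₑ * ‖f ((-t) +ᵥ ω)‖ₑ := by
      intro t
      simp only [Pi.mul_apply]
      rw [← mul_assoc, ← ENNReal.rpow_add_of_nonneg _ _ (by norm_num) (by norm_num)]
      norm_num
    have h4 : ∀ t, (‖α t‖ₑ ^ (1 / 2 : ℝ)) ^ (2 : ℝ) = ‖α t‖ₑ := by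
      intro t
      rw [← ENNReal.rpow_mul]; norm_num
    have h5 : ∀ t, (‖α t‖ₑ ^ (1 / 2 : ℝ) * ‖f ((-t) +ᵥ ω)‖ₑ) ^ (2 : ℝ) =
        ‖α t‖ₑ * ‖f ((-t) +ᵥ ω)‖ₑ ^ (2 : ℝ) := by
      intro t
      rw [ENNReal.mul_rpow_of_nonneg _ _ (by norm_num), h4]
    simp only [h3, h4, h5] at h2
    calc ‖mol α f ω‖ₑ ^ (2 : ℝ)
        ≤ (A ^ (1 / 2 : ℝ) * (∫⁻ t, ‖α t‖ₑ * ‖f ((-t) +ᵥ ω)‖ₑ ^ (2 : ℝ)) ^ (1 / 2 : ℝ)) ^ (2 : ℝ) :=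
          ENNReal.rpow_le_rpow (h1.trans h2) (by norm_num)
      _ = _ := by
          rw [ENNReal.mul_rpow_of_nonneg _ _ (by norm_num), ← ENNReal.rpow_mul,
            ← ENNReal.rpow_mul]
          norm_num
  refine (lintegral_mono hpt).trans_lt ?_
  have hA' : A ≠ ∞ := hα.integrable.hasFiniteIntegral.ne
  rw [lintegral_const_mul' _ _ hA', lintegral_lintegral_neg_vadd (hfm.enorm.pow_const _)
    hα.measurable.enorm]
  exact ENNReal.mul_lt_top hA'.lt_top (ENNReal.mul_lt_top hA'.lt_top hf2)

/-! ### Iterated mollification -/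

lemma mol_mol {α β : Eucl d → ℝ} (hα : IsTest α) (hβ : IsTest β) {f : Ω → ℝ} {ω : Ω}
    (hf : LocallyIntegrable (realisation (d := d) f ω)) :
    mol α (mol β f) ω = ((α ⋆[ContinuousLinearMap.lsmul ℝ ℝ, volume] β)
      ⋆[ContinuousLinearMap.lsmul ℝ ℝ, volume] realisation f ω) 0 := by
  have hn : LocallyIntegrable (fun x => ‖realisation (d := d) f ω x‖) := fun x => (hf x).norm
  rw [mol_eq_convolution, realisation_mol, convolution_assoc
    (L₃ := ContinuousLinearMap.lsmul ℝ ℝ) (L₄ := ContinuousLinearMap.lsmul ℝ ℝ)]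
  · intro x y z; simp [mul_assoc]
  · exact hα.continuous.aestronglyMeasurable
  · exact hβ.continuous.aestronglyMeasurable
  · exact hf.aestronglyMeasurable
  · exact Eventually.of_forall (hα.hasCompactSupport.convolutionExists_left _ hα.continuous
      hβ.continuous.locallyIntegrable)
  · exact Eventually.of_forall (hβ.hasCompactSupport.norm.convolutionExists_left _
      hβ.continuous.norm hn)
  · refine hα.hasCompactSupport.norm.convolutionExists_left _ hα.continuous.norm ?_ 0
    exact (hβ.hasCompactSupport.norm.continuous_convolution_left _ hβ.continuous.norm
      hn).locallyIntegrable

lemma pd_convolution {α β : Eucl d → ℝ} (hα : IsTest α) (hβ : IsTest β) (j : Fin d) :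
    (pd j α ⋆[ContinuousLinearMap.lsmul ℝ ℝ, volume] β) =
      (α ⋆[ContinuousLinearMap.lsmul ℝ ℝ, volume] pd j β) := by
  ext x
  have h1 := hα.hasCompactSupport.hasFDerivAt_convolution_left (ContinuousLinearMap.lsmul ℝ ℝ)
    hα.contDiff_one hβ.continuous.locallyIntegrable (μ := volume) x
  have h2 := hβ.hasCompactSupport.hasFDerivAt_convolution_right (ContinuousLinearMap.lsmul ℝ ℝ)
    hα.continuous.locallyIntegrable hβ.contDiff_one (μ := volume) x
  have h := congrArg (fun L => L (EuclideanSpace.single j 1)) (h1.unique h2)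
  rw [convolution_precompL_apply hα hβ.continuous.locallyIntegrable,
    convolution_precompR_apply _ hα.continuous.locallyIntegrable
      (hβ.hasCompactSupport.fderiv ℝ) (hβ.contDiff_one.continuous_fderiv one_ne_zero)] at h
  exact h

/-- On the orbit both sides convolve the realisation with one and the same kernel, since `∂_j α ⋆ β
= α ⋆ ∂_j β`. This passes a derivative from one mollifier to the other. -/
lemma mol_pd_mol {α β : Eucl d → ℝ} (hα : IsTest α) (hβ : IsTest β) {f : Ω → ℝ} {ω : Ω}
    (hf : LocallyIntegrable (realisation (d := d) f ω)) (j : Fin d) :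
    mol (pd j α) (mol β f) ω = mol α (mol (pd j β) f) ω := by
  rw [mol_mol (hα.pd j) hβ hf, mol_mol hα (hβ.pd j) hf, pd_convolution hα hβ]

/-! ### An approximate identity -/

/-- Bump functions shrinking to the origin. -/
noncomputable def bump (d n : ℕ) : ContDiffBump (0 : Eucl d) where
  rIn := 1 / (n + 1)
  rOut := 2 * (1 / (n + 1))
  rIn_pos := by positivity
  rIn_lt_rOut := by
    have : (0 : ℝ) < 1 / (n + 1) := by positivity
    linarith

/-- A smooth approximate identity on `ℝ^d`. -/
noncomputable def approxId (d n : ℕ) : Eucl d → ℝ := (bump d n).normed volume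

lemma isTest_approxId (n : ℕ) : IsTest (approxId d n) :=
  ⟨(bump d n).contDiff_normed, (bump d n).hasCompactSupport_normed⟩

lemma approxId_neg (n : ℕ) (x : Eucl d) : approxId d n (-x) = approxId d n x :=
  (bump d n).normed_neg x

lemma approxId_nonneg (n : ℕ) (x : Eucl d) : 0 ≤ approxId d n x :=
  (bump d n).nonneg_normed x

lemma integral_approxId (n : ℕ) : ∫ x, approxId d n x = 1 :=
  (bump d n).integral_normed

/-- Lebesgue's differentiation theorem gives convergence at almost every point of almost every
orbit; `ae_of_ae_ae_vadd` converts this into almost sure convergence. -/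
lemma ae_tendsto_mol_approxId {f : Ω → ℝ} (hfm : Measurable f) (hf : Integrable f μ) :
    ∀ᵐ ω ∂μ, Tendsto (fun n => mol (approxId d n) f ω) atTop (𝓝 (f ω)) := by
  refine ae_of_ae_ae_vadd (d := d)
    (measurableSet_tendsto_fun (fun n => measurable_mol (isTest_approxId n).measurable hfm) hfm) ?_
  filter_upwards [ae_locallyIntegrable (d := d) hfm hf] with ω hω
  have h0 : Tendsto (fun n : ℕ => (1 : ℝ) / (n + 1)) atTop (𝓝 0) :=
    tendsto_one_div_add_atTop_nhds_zero_nat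
  have h1 : Tendsto (fun n : ℕ => (bump d n).rOut) atTop (𝓝 0) := by
    simpa [bump] using h0.const_mul 2
  -- The constant `2` is the ratio `rOut / rIn` of `bump`; a bounded ratio is what the
  -- differentiation theorem requires.
  have h2 := ContDiffBump.ae_convolution_tendsto_right_of_locallyIntegrable
    (K := 2) h1 (Eventually.of_forall fun n => le_rfl) hω
  filter_upwards [h2] with x hx
  have : ∀ n, mol (approxId d n) f (x +ᵥ ω) =
      ((bump d n).normed volume ⋆[ContinuousLinearMap.lsmul ℝ ℝ, volume] realisation f ω) x := by
    intro n
    rw [← realisation_apply (mol (approxId d n) f), realisation_mol]; rfl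
  simp only [this]
  exact hx

end StationaryVar

namespace StationaryVar

variable {d : ℕ} {Ω : Type*} [AddAction (Eucl d) Ω]

/-! ### Functions with smooth realisations and bounded derivatives -/

/-- The classical `j`-th partial derivative on `Ω`. -/
noncomputable def cpd (j : Fin d) (f : Ω → ℝ) (ω : Ω) : ℝ :=
  pd j (realisation f ω) 0

lemma realisation_vadd_eq {X : Type*} (f : Ω → X) (ω : Ω) (z : Eucl d) :
    realisation (d := d) f (z +ᵥ ω) = fun x => realisation f ω (x + z) := by
  ext x; exact realisation_vadd f ω x z

lemma pd_realisation (j : Fin d) (f : Ω → ℝ) (ω : Ω) :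
    pd j (realisation f ω) = realisation (cpd j f) ω := by
  ext x
  simp only [realisation_apply, cpd, pd]
  rw [realisation_vadd_eq, fderiv_comp_add_right, zero_add]

lemma cpd_mol {α : Eucl d → ℝ} (hα : IsTest α) {f : Ω → ℝ}
    (hf : ∀ ω, LocallyIntegrable (realisation (d := d) f ω)) (j : Fin d) :
    cpd j (mol α f) = mol (pd j α) f := by
  ext ω
  rw [cpd, pd_realisation_mol hα (hf ω), realisation_zero]

lemma hasDerivAt_line {f : Ω → ℝ} {ω : Ω} (hf : Differentiable ℝ (realisation (d := d) f ω))
    (j : Fin d) (s : ℝ) :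
    HasDerivAt (fun s : ℝ => f ((s • EuclideanSpace.single j (1 : ℝ) : Eucl d) +ᵥ ω))
      (cpd j f ((s • EuclideanSpace.single j (1 : ℝ) : Eucl d) +ᵥ ω)) s := by
  have h1 : HasDerivAt (fun s : ℝ => (s • EuclideanSpace.single j (1 : ℝ) : Eucl d))
      (EuclideanSpace.single j (1 : ℝ)) s := by
    simpa using (hasDerivAt_id s).smul_const (EuclideanSpace.single j (1 : ℝ) : Eucl d)
  have h2 := (hf (s • EuclideanSpace.single j (1 : ℝ))).hasFDerivAt.comp_hasDerivAt s h1
  rw [← realisation_apply (cpd j f), ← pd_realisation]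
  exact h2

/-- Presents `cpd` as a sequential limit of difference quotients on `Ω`, from which both its
measurability and its vanishing mean are read off. -/
lemma tendsto_diffQuot {f : Ω → ℝ} {ω : Ω} (hf : Differentiable ℝ (realisation (d := d) f ω))
    (j : Fin d) :
    Tendsto (fun n : ℕ => ((1 : ℝ) / (n + 1))⁻¹ *
      (f ((((1 : ℝ) / (n + 1)) • EuclideanSpace.single j (1 : ℝ) : Eucl d) +ᵥ ω) - f ω))
      atTop (𝓝 (cpd j f ω)) := by
  have h := hasDerivAt_iff_tendsto_slope_zero.1 (hasDerivAt_line hf j 0)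
  simp only [zero_add, zero_smul, zero_vadd, smul_eq_mul] at h
  refine h.comp (tendsto_nhdsWithin_iff.2 ⟨tendsto_one_div_add_atTop_nhds_zero_nat, ?_⟩)
  refine Eventually.of_forall fun n => ?_
  have : (0 : ℝ) < 1 / (n + 1) := by positivity
  exact this.ne'

namespace SmoothBounded

variable {X Y : Type*} [NormedAddCommGroup X] [NormedSpace ℝ X] [NormedAddCommGroup Y]
  [NormedSpace ℝ Y]

lemma exists_norm_le {f : Ω → X} (hf : SmoothBounded d f) : ∃ C : ℝ, ∀ ω, ‖f ω‖ ≤ C := by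
  obtain ⟨C, hC⟩ := hf.2 0
  refine ⟨C, fun ω => ?_⟩
  have := hC ω
  rwa [norm_iteratedFDeriv_zero, realisation_zero] at this

lemma differentiable {f : Ω → X} (hf : SmoothBounded d f) (ω : Ω) :
    Differentiable ℝ (realisation (d := d) f ω) :=
  (hf.1 ω).differentiable (by simp)

lemma exists_fderiv_le {f : Ω → X} (hf : SmoothBounded d f) :
    ∃ C : ℝ, ∀ ω, ‖fderiv ℝ (realisation (d := d) f ω) 0‖ ≤ C := by
  obtain ⟨C, hC⟩ := hf.2 1
  refine ⟨C, fun ω => ?_⟩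
  have := hC ω
  rwa [norm_iteratedFDeriv_one] at this

lemma exists_cpd_le {f : Ω → ℝ} (hf : SmoothBounded d f) :
    ∃ C : ℝ, ∀ j ω, |cpd (d := d) j f ω| ≤ C := by
  obtain ⟨C, hC⟩ := hf.exists_fderiv_le
  refine ⟨C, fun j ω => ?_⟩
  have h := (fderiv ℝ (realisation (d := d) f ω) 0).le_opNorm (EuclideanSpace.single j 1)
  rw [PiLp.norm_single, norm_one, mul_one] at h
  exact h.trans (hC ω)

lemma clm_comp {f : Ω → X} (hf : SmoothBounded d f) (L : X →L[ℝ] Y) :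
    SmoothBounded d fun ω => L (f ω) := by
  refine ⟨fun ω => L.contDiff.comp (hf.1 ω), fun n => ?_⟩
  obtain ⟨C, hC⟩ := hf.2 n
  refine ⟨‖L‖ * C, fun ω => ?_⟩
  have : realisation (d := d) (fun ω => L (f ω)) ω = L ∘ realisation f ω := rfl
  rw [this]
  refine (L.norm_iteratedFDeriv_comp_left (hf.1 ω).contDiffAt (by exact_mod_cast le_top)).trans ?_
  exact mul_le_mul_of_nonneg_left (hC ω) (norm_nonneg _)

lemma add {f g : Ω → X} (hf : SmoothBounded d f) (hg : SmoothBounded d g) :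
    SmoothBounded d fun ω => f ω + g ω := by
  refine ⟨fun ω => (hf.1 ω).add (hg.1 ω), fun n => ?_⟩
  obtain ⟨C, hC⟩ := hf.2 n
  obtain ⟨K, hK⟩ := hg.2 n
  refine ⟨C + K, fun ω => ?_⟩
  have : realisation (d := d) (fun ω => f ω + g ω) ω = realisation f ω + realisation g ω := rfl
  rw [this, iteratedFDeriv_add_apply ((hf.1 ω).of_le (by exact_mod_cast le_top)).contDiffAt
    ((hg.1 ω).of_le (by exact_mod_cast le_top)).contDiffAt]
  exact (norm_add_le _ _).trans (add_le_add (hC ω) (hK ω))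

lemma of_realisation_const {f : Ω → X} {C : ℝ} (hC : ∀ ω, ‖f ω‖ ≤ C)
    (hf : ∀ ω, ∀ x : Eucl d, f (x +ᵥ ω) = f ω) : SmoothBounded d f := by
  have h : ∀ ω, realisation (d := d) f ω = fun _ => f ω := fun ω => funext fun x => hf ω x
  refine ⟨fun ω => ?_, fun n => ?_⟩
  · rw [h]; exact contDiff_const
  · refine ⟨C, fun ω => ?_⟩
    rw [h]
    rcases Nat.eq_zero_or_pos n with rfl | hn
    · rw [norm_iteratedFDeriv_zero]; exact hC ω
    · rw [iteratedFDeriv_const_of_ne hn.ne']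
      simpa using (norm_nonneg _).trans (hC ω)

end SmoothBounded

variable [MeasurableSpace Ω] [MeasurableVAdd₂ (Eucl d) Ω]

lemma measurable_cpd {f : Ω → ℝ} (hfm : Measurable f)
    (hf : ∀ ω, Differentiable ℝ (realisation (d := d) f ω)) (j : Fin d) :
    Measurable (cpd j f) := by
  refine measurable_of_tendsto_metrizable (fun n => ?_)
    (tendsto_pi_nhds.2 fun ω => tendsto_diffQuot (hf ω) j)
  exact ((measurable_comp_vadd hfm _).sub hfm).const_mul _

variable {μ : Measure Ω} [IsProbabilityMeasure μ] [VAddInvariantMeasure (Eucl d) Ω μ]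

lemma integrable_of_bound {E : Type*} [NormedAddCommGroup E] {f : Ω → E}
    (hfm : AEStronglyMeasurable f μ) {C : ℝ} (hC : ∀ ω, ‖f ω‖ ≤ C) : Integrable f μ :=
  Integrable.of_bound hfm C (Eventually.of_forall hC)

/-- By stationarity, derivatives have mean zero. -/
lemma integral_cpd_eq_zero {f : Ω → ℝ} (hfm : Measurable f)
    (hf : ∀ ω, Differentiable ℝ (realisation (d := d) f ω)) {C K : ℝ} (hC : ∀ ω, ‖f ω‖ ≤ C)
    (j : Fin d) (hK : ∀ ω, |cpd j f ω| ≤ K) : ∫ ω, cpd j f ω ∂μ = 0 := by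
  have hfi : Integrable f μ := integrable_of_bound hfm.aestronglyMeasurable hC
  have hlim := tendsto_integral_of_dominated_convergence (μ := μ)
    (F := fun (n : ℕ) ω => ((1 : ℝ) / (n + 1))⁻¹ *
      (f ((((1 : ℝ) / (n + 1)) • EuclideanSpace.single j (1 : ℝ) : Eucl d) +ᵥ ω) - f ω))
    (f := cpd j f) (fun _ => K)
    (fun n => (((measurable_comp_vadd hfm _).sub hfm).const_mul _).aestronglyMeasurable)
    (integrable_const K) (fun n => Eventually.of_forall fun ω => ?_)
    (Eventually.of_forall fun ω => tendsto_diffQuot (hf ω) j)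
  · refine tendsto_nhds_unique hlim ?_
    have h0 : ∀ n : ℕ, ∫ ω, ((1 : ℝ) / (n + 1))⁻¹ *
      (f ((((1 : ℝ) / (n + 1)) • EuclideanSpace.single j (1 : ℝ) : Eucl d) +ᵥ ω) - f ω) ∂μ = 0 := by
      intro n
      rw [integral_const_mul, integral_sub _ hfi, integral_comp_vadd, sub_self, mul_zero]
      exact (measurePreserving_vadd' _).integrable_comp_of_integrable hfi
    simp only [h0]
    exact tendsto_const_nhds
  · have hpos : (0 : ℝ) < 1 / (n + 1) := by positivity
    -- The mean value inequality along the orbit bounds every difference quotient by `K`, the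
    -- dominating constant.
    have h := Convex.norm_image_sub_le_of_norm_hasDerivWithin_le
      (f := fun s : ℝ => f ((s • EuclideanSpace.single j (1 : ℝ) : Eucl d) +ᵥ ω)) (s := Set.univ)
      (fun s _ => (hasDerivAt_line (hf ω) j s).hasDerivWithinAt)
      (fun s _ => hK _) convex_univ (Set.mem_univ 0) (Set.mem_univ ((1 : ℝ) / (n + 1)))
    simp only [zero_smul, zero_vadd, sub_zero] at h
    rw [norm_mul, norm_inv, Real.norm_of_nonneg hpos.le]
    rw [Real.norm_of_nonneg hpos.le] at h
    rw [inv_mul_le_iff₀ hpos, mul_comm]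
    exact h

/-! ### Weak derivatives -/

omit [MeasurableSpace Ω] [MeasurableVAdd₂ (Eucl d) Ω] in
lemma hasWeakPartialEucl_of_contDiff {u : Eucl d → ℝ} (hu : ContDiff ℝ (⊤ : ℕ∞) u) (i : Fin d) :
    HasWeakPartialEucl i u (pd i u) := by
  have hpd : Continuous (pd i u) :=
    ((hu.fderiv_right (m := (⊤ : ℕ∞)) (by simp)).clm_apply contDiff_const).continuous
  refine ⟨hu.continuous.locallyIntegrable, hpd.locallyIntegrable, fun ψ hψ hψc => ?_⟩
  have hψ' : IsTest ψ := ⟨hψ, hψc⟩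
  refine integral_mul_fderiv_eq_neg_fderiv_mul_of_integrable ?_ ?_ ?_ ?_ ?_
  · exact (hpd.mul hψ.continuous).integrable_of_hasCompactSupport hψc.mul_left
  · exact (hu.continuous.mul (hψ'.pd i).continuous).integrable_of_hasCompactSupport
      (hψ'.pd i).hasCompactSupport.mul_left
  · exact (hu.continuous.mul hψ.continuous).integrable_of_hasCompactSupport hψc.mul_left
  · exact fun x _ => hu.differentiable (by simp) x
  · exact fun x _ => hψ.differentiable (by simp) x

lemma SmoothBounded.hasWeakPartial {f : Ω → ℝ} (hfm : Measurable f) (hf : SmoothBounded d f)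
    (i : Fin d) : HasWeakPartial μ i f (cpd i f) := by
  refine ⟨measurable_cpd hfm hf.differentiable i, Eventually.of_forall fun ω => ?_⟩
  rw [← pd_realisation]
  exact hasWeakPartialEucl_of_contDiff (hf.1 ω) i

omit [MeasurableSpace Ω] [MeasurableVAdd₂ (Eucl d) Ω] in
lemma HasWeakPartialEucl.ae_eq {i : Fin d} {u v v' : Eucl d → ℝ} (h : HasWeakPartialEucl i u v)
    (h' : HasWeakPartialEucl i u v') : v =ᵐ[volume] v' := by
  refine ae_eq_of_integral_contDiff_smul_eq h.2.1 h'.2.1 fun ψ hψ hψc => ?_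
  have := (h.2.2 ψ hψ hψc).symm.trans (h'.2.2 ψ hψ hψc)
  simpa [mul_comm] using this

omit [MeasurableSpace Ω] [MeasurableVAdd₂ (Eucl d) Ω] in
lemma HasWeakPartialEucl.sub {i : Fin d} {u v u' v' : Eucl d → ℝ} (h : HasWeakPartialEucl i u v)
    (h' : HasWeakPartialEucl i u' v') : HasWeakPartialEucl i (u - u') (v - v') := by
  refine ⟨h.1.sub h'.1, h.2.1.sub h'.2.1, fun ψ hψ hψc => ?_⟩
  have hψ' : IsTest ψ := ⟨hψ, hψc⟩
  have hint : ∀ {w χ : Eucl d → ℝ}, LocallyIntegrable w → IsTest χ →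
      Integrable fun x => w x * χ x := by
    intro w χ hw hχ
    simpa [mul_comm] using hw.integrable_smul_left_of_hasCompactSupport hχ.continuous
      hχ.hasCompactSupport
  have h1 : ∫ x, u x * pd i ψ x = _ := h.2.2 ψ hψ hψc
  have h2 : ∫ x, u' x * pd i ψ x = _ := h'.2.2 ψ hψ hψc
  change ∫ x, (u - u') x * pd i ψ x = _
  simp only [Pi.sub_apply, sub_mul]
  rw [integral_sub (hint h.1 (hψ'.pd i)) (hint h'.1 (hψ'.pd i)),
    integral_sub (hint h.2.1 hψ') (hint h'.2.1 hψ'), h1, h2]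
  ring

lemma HasWeakPartial.ae_eq {i : Fin d} {f g g' : Ω → ℝ} (h : HasWeakPartial μ i f g)
    (h' : HasWeakPartial μ i f g') : g =ᵐ[μ] g' := by
  refine ae_of_ae_ae_vadd (d := d) (measurableSet_eq_fun h.1 h'.1) ?_
  filter_upwards [h.2, h'.2] with ω h1 h2
  exact h1.ae_eq h2

lemma HasWeakPartial.sub {i : Fin d} {f g f' g' : Ω → ℝ} (h : HasWeakPartial μ i f g)
    (h' : HasWeakPartial μ i f' g') : HasWeakPartial μ i (f - f') (g - g') := by
  refine ⟨h.1.sub h'.1, ?_⟩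
  filter_upwards [h.2, h'.2] with ω h1 h2
  exact h1.sub h2

lemma HasWeakPartial.weakPartial_ae_eq {i : Fin d} {f g : Ω → ℝ} (h : HasWeakPartial μ i f g) :
    weakPartial μ i f =ᵐ[μ] g := by
  have hex : ∃ g, HasWeakPartial μ i f g := ⟨g, h⟩
  rw [weakPartial, dif_pos hex]
  exact hex.choose_spec.ae_eq h

lemma hasWeakPartial_weakPartial {i : Fin d} {f : Ω → ℝ} (h : ∃ g, HasWeakPartial μ i f g) :
    HasWeakPartial μ i f (weakPartial μ i f) := by
  rw [weakPartial, dif_pos h]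
  exact h.choose_spec

lemma measurable_weakPartial (i : Fin d) (f : Ω → ℝ) : Measurable (weakPartial μ i f) := by
  by_cases h : ∃ g, HasWeakPartial μ i f g
  · exact (hasWeakPartial_weakPartial h).1
  · rw [weakPartial, dif_neg h]; exact measurable_const

lemma weakPartial_sub {i : Fin d} {f f' : Ω → ℝ} (h : ∃ g, HasWeakPartial μ i f g)
    (h' : ∃ g, HasWeakPartial μ i f' g) :
    weakPartial μ i (f - f') =ᵐ[μ] weakPartial μ i f - weakPartial μ i f' :=
  ((hasWeakPartial_weakPartial h).sub (hasWeakPartial_weakPartial h')).weakPartial_ae_eq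

/-- The definition of the weak derivative, tested with the reflected kernel `x ↦ α (-x)`; the sign
of the reflection cancels that of the integration by parts. -/
lemma mol_pd_ae_eq {α : Eucl d → ℝ} (hα : IsTest α) {i : Fin d} {f g : Ω → ℝ}
    (h : HasWeakPartial μ i f g) : mol (pd i α) f =ᵐ[μ] mol α g := by
  filter_upwards [h.2] with ω hω
  have h1 := hω.2.2 _ hα.comp_neg.contDiff hα.comp_neg.hasCompactSupport
  have h2 : ∀ x, fderiv ℝ (fun x => α (-x)) x (EuclideanSpace.single i 1) = - pd i α (-x) :=
    fun x => pd_comp_neg hα i x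
  simp only [h2, mul_neg, integral_neg, neg_inj] at h1
  rw [mol, mol, ← integral_neg_eq_self, ← integral_neg_eq_self (fun t => α t * _)]
  simp only [neg_neg]
  simpa only [mul_comm, realisation_apply] using h1

lemma SmoothBounded.mem_Dw {f : Ω → ℝ} (hfm : Measurable f) (hf : SmoothBounded d f) :
    f ∈ Dw d μ := by
  obtain ⟨C, hC⟩ := hf.exists_norm_le
  obtain ⟨K, hK⟩ := hf.exists_cpd_le
  refine ⟨hfm, MemLp.of_bound hfm.aestronglyMeasurable C (Eventually.of_forall hC), fun i => ?_⟩
  have hw := hf.hasWeakPartial (μ := μ) hfm i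
  refine ⟨⟨_, hw⟩, (memLp_congr_ae hw.weakPartial_ae_eq).2 ?_⟩
  exact MemLp.of_bound hw.1.aestronglyMeasurable K (Eventually.of_forall (hK i))

/-! ### The classical gradient -/

omit [MeasurableSpace Ω] [MeasurableVAdd₂ (Eucl d) Ω] in
lemma inner_classicalGrad (f : Ω → ℝ) (ω : Ω) (v : Eucl d) :
    inner ℝ (classicalGrad f ω) v = ∑ j, cpd j f ω * v j := by
  rw [classicalGrad, gradient, InnerProductSpace.toDual_symm_apply, clm_eq_sum (fderiv ℝ _ _)]
  simp [cpd, pd]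

omit [MeasurableSpace Ω] [MeasurableVAdd₂ (Eucl d) Ω] in
lemma classicalGrad_apply (f : Ω → ℝ) (ω : Ω) (j : Fin d) :
    classicalGrad f ω j = cpd j f ω := by
  have := inner_classicalGrad f ω (EuclideanSpace.single j 1)
  rw [EuclideanSpace.inner_single_right] at this
  simpa [Pi.single_apply] using this

lemma SmoothBounded.weakGrad_ae_eq {f : Ω → ℝ} (hfm : Measurable f) (hf : SmoothBounded d f) :
    weakGrad μ f =ᵐ[μ] classicalGrad (d := d) f := by
  have h : ∀ᵐ ω ∂μ, ∀ i : Fin d, weakPartial μ i f ω = cpd i f ω :=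
    ae_all_iff.2 fun i => (hf.hasWeakPartial hfm i).weakPartial_ae_eq
  filter_upwards [h] with ω hω
  ext i
  rw [classicalGrad_apply, ← hω i]; rfl

lemma measurable_classicalGrad {f : Ω → ℝ} (hfm : Measurable f)
    (hf : SmoothBounded d f) : Measurable (classicalGrad (d := d) f) := by
  have : classicalGrad (d := d) f = fun ω => WithLp.toLp 2 fun j => cpd j f ω := by
    ext ω j; exact classicalGrad_apply f ω j
  rw [this]
  exact (WithLp.measurable_toLp 2 _).comp
    (measurable_pi_lambda _ fun j => measurable_cpd hfm hf.differentiable j)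

omit [MeasurableSpace Ω] [MeasurableVAdd₂ (Eucl d) Ω] in
lemma SmoothBounded.exists_classicalGrad_le {f : Ω → ℝ} (hf : SmoothBounded d f) :
    ∃ C : ℝ, ∀ ω, ‖classicalGrad (d := d) f ω‖ ≤ C := by
  obtain ⟨C, hC⟩ := hf.exists_fderiv_le
  refine ⟨C, fun ω => ?_⟩
  rw [classicalGrad, gradient, LinearIsometryEquiv.norm_map]
  exact hC ω

end StationaryVar

namespace StationaryVar

variable {d : ℕ} {Ω : Type*} [AddAction (Eucl d) Ω]

/-! ### Divergence-free fields -/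

lemma SmoothBounded.component {φ : Ω → Eucl d} (hφ : SmoothBounded d φ) (i : Fin d) :
    SmoothBounded d fun ω => φ ω i :=
  hφ.clm_comp (EuclideanSpace.proj i : Eucl d →L[ℝ] ℝ)

lemma divergence_eq_sum_cpd {φ : Ω → Eucl d} {ω : Ω}
    (hφ : Differentiable ℝ (realisation (d := d) φ ω)) :
    divergence φ ω = ∑ i, cpd i (fun ω => φ ω i) ω := by
  refine Finset.sum_congr rfl fun i _ => ?_
  have h : HasFDerivAt (realisation (d := d) (fun ω => φ ω i) ω)
      ((EuclideanSpace.proj i : Eucl d →L[ℝ] ℝ).comp (fderiv ℝ (realisation φ ω) 0)) 0 :=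
    (EuclideanSpace.proj i : Eucl d →L[ℝ] ℝ).hasFDerivAt.comp 0 (hφ 0).hasFDerivAt
  rw [cpd, pd, h.fderiv]
  rfl

lemma cpd_mul {f g : Ω → ℝ} {ω : Ω} (hf : Differentiable ℝ (realisation (d := d) f ω))
    (hg : Differentiable ℝ (realisation (d := d) g ω)) (j : Fin d) :
    cpd j (fun ω => f ω * g ω) ω = f ω * cpd j g ω + cpd j f ω * g ω := by
  have h : HasFDerivAt (realisation (d := d) (fun ω => f ω * g ω) ω) _ 0 :=
    (hf 0).hasFDerivAt.mul (hg 0).hasFDerivAt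
  rw [cpd, pd, h.fderiv]
  simp only [add_apply, smul_apply,
    smul_eq_mul, cpd, pd, realisation_zero, zero_vadd]
  ring

variable [MeasurableSpace Ω] [MeasurableVAdd₂ (Eucl d) Ω]

lemma measurable_component {φ : Ω → Eucl d} (hφ : Measurable φ) (i : Fin d) :
    Measurable fun ω => φ ω i :=
  (EuclideanSpace.proj i : Eucl d →L[ℝ] ℝ).continuous.measurable.comp hφ

variable {μ : Measure Ω} [IsProbabilityMeasure μ] [VAddInvariantMeasure (Eucl d) Ω μ]

omit [MeasurableVAdd₂ (Eucl d) Ω] [IsProbabilityMeasure μ] [VAddInvariantMeasure (Eucl d) Ω μ] in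
lemma memLp_component {p : ℝ≥0∞} {φ : Ω → Eucl d} (hφ : MemLp φ p μ) (i : Fin d) :
    MemLp (fun ω => φ ω i) p μ :=
  (EuclideanSpace.proj i : Eucl d →L[ℝ] ℝ).comp_memLp' hφ

/-- Integration by parts against a divergence-free field. -/
lemma integral_inner_classicalGrad_eq_zero {w : Ω → ℝ} (hwm : Measurable w)
    (hw : SmoothBounded d w) {φ : Ω → Eucl d} (hφm : Measurable φ) (hφ : SmoothBounded d φ)
    (hdiv : ∀ ω, divergence φ ω = 0) :
    ∫ ω, inner ℝ (classicalGrad w ω) (φ ω) ∂μ = 0 := by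
  have hcomp := fun j => hφ.component j
  have hdiff : ∀ j ω, Differentiable ℝ (realisation (d := d) (fun ω => w ω * φ ω j) ω) :=
    fun j ω => (hw.differentiable ω).mul ((hcomp j).differentiable ω)
  have hm : ∀ j, Measurable fun ω => w ω * φ ω j := fun j => hwm.mul (measurable_component hφm j)
  obtain ⟨C, hC⟩ := hw.exists_norm_le
  obtain ⟨K, hK⟩ := hw.exists_cpd_le
  choose C' hC' using fun j => (hcomp j).exists_norm_le
  choose K' hK' using fun j => (hcomp j).exists_cpd_le
  have hb : ∀ j ω, |cpd j (fun ω => w ω * φ ω j) ω| ≤ C * K' j + K * C' j := by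
    intro j ω
    rw [cpd_mul (hw.differentiable ω) ((hcomp j).differentiable ω)]
    refine (abs_add_le _ _).trans ?_
    rw [abs_mul, abs_mul]
    have h1 := hC ω
    have h2 := hC' j ω
    rw [Real.norm_eq_abs] at h1 h2
    exact add_le_add
      (mul_le_mul h1 (hK' j j ω) (abs_nonneg _) ((abs_nonneg _).trans h1))
      (mul_le_mul (hK j ω) h2 (abs_nonneg _) ((abs_nonneg _).trans (hK j ω)))
  have hz : ∀ j, ∫ ω, cpd j (fun ω => w ω * φ ω j) ω ∂μ = 0 := by
    intro j
    refine integral_cpd_eq_zero (hm j) (hdiff j) (C := C * C' j) (fun ω => ?_) j (hb j)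
    rw [norm_mul]
    exact mul_le_mul (hC ω) (hC' j ω) (norm_nonneg _) ((norm_nonneg _).trans (hC ω))
  -- The product rule: `∇w · φ = ∇ · (w φ) - w ∇ · φ`, and the last term is zero.
  have hsum : ∀ ω, inner ℝ (classicalGrad w ω) (φ ω) =
      ∑ j, cpd j (fun ω => w ω * φ ω j) ω := by
    intro ω
    have h0 : ∀ j, cpd j (fun ω => w ω * φ ω j) ω =
        w ω * cpd j (fun ω => φ ω j) ω + cpd j w ω * φ ω j :=
      fun j => cpd_mul (hw.differentiable ω) ((hcomp j).differentiable ω) j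
    rw [inner_classicalGrad]
    simp only [h0, Finset.sum_add_distrib]
    rw [← Finset.mul_sum, ← divergence_eq_sum_cpd (hφ.differentiable ω), hdiv ω, mul_zero, zero_add]
  simp only [hsum]
  rw [integral_finsetSum _ fun j _ => integrable_of_bound
    (measurable_cpd (hm j) (hdiff j) j).aestronglyMeasurable (hb j)]
  exact Finset.sum_eq_zero fun j _ => hz j

variable (d Ω) in
/-- The smooth bounded divergence-free fields, of arbitrary mean. -/
def smoothDivFree : Set (Ω → Eucl d) :=
  {φ | Measurable φ ∧ SmoothBounded d φ ∧ ∀ ω, divergence φ ω = 0}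

/-- The square integrable weakly divergence-free fields, of arbitrary mean. -/
def weakDivFree (μ : Measure Ω) : Set (Ω → Eucl d) :=
  {φ | Measurable φ ∧ MemLp φ 2 μ ∧ ∀ w ∈ Ds d μ, ∫ ω, inner ℝ (classicalGrad w ω) (φ ω) ∂μ = 0}

lemma smoothDivFree_subset : smoothDivFree d Ω ⊆ weakDivFree μ := by
  rintro φ ⟨hm, hs, hdiv⟩
  obtain ⟨C, hC⟩ := hs.exists_norm_le
  exact ⟨hm, MemLp.of_bound hm.aestronglyMeasurable C (Eventually.of_forall hC),
    fun w hw => integral_inner_classicalGrad_eq_zero hw.1.1 hw.2 hm hs hdiv⟩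

/-- The bounded test function `D / (1 + |D|)` makes the integrand nonnegative and positive wherever
`D ≠ 0`. -/
lemma ae_eq_zero_of_forall_integral_mul {D : Ω → ℝ} (hD : Measurable D) (hDi : Integrable D μ)
    (h : ∀ g : Ω → ℝ, Measurable g → (∀ ω, |g ω| ≤ 1) → ∫ ω, g ω * D ω ∂μ = 0) :
    D =ᵐ[μ] 0 := by
  have hpos : ∀ ω, 0 < 1 + |D ω| := fun ω => by positivity
  have hgm : Measurable fun ω => D ω / (1 + |D ω|) := hD.div (measurable_const.add hD.abs)
  have hg1 : ∀ ω, |D ω / (1 + |D ω|)| ≤ 1 := by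
    intro ω
    rw [abs_div, abs_of_pos (hpos ω), div_le_one (hpos ω)]
    linarith
  have hnn : ∀ ω, 0 ≤ D ω / (1 + |D ω|) * D ω := by
    intro ω
    rw [div_mul_eq_mul_div]
    exact div_nonneg (mul_self_nonneg _) (hpos ω).le
  have h0 := h _ hgm hg1
  rw [integral_eq_zero_iff_of_nonneg hnn (hDi.bdd_mul hgm.aestronglyMeasurable
    (Eventually.of_forall hg1))] at h0
  filter_upwards [h0] with ω hω
  have := (hpos ω).ne'
  simpa [div_mul_eq_mul_div, this] using hω

lemma integrable_mul_of_memLp_two {f g : Ω → ℝ} (hf : MemLp f 2 μ) (hg : MemLp g 2 μ) :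
    Integrable (fun ω => f ω * g ω) μ :=
  hf.integrable_mul hg

/-! ### Weakly divergence-free fields orthogonal to all smooth divergence-free fields. -/

section Orthogonal

variable {ψ : Ω → Eucl d}

lemma inner_smul_single (a : ℝ) (i : Fin d) (v : Eucl d) :
    inner ℝ (a • EuclideanSpace.single i (1 : ℝ)) v = a * v i := by
  rw [real_inner_smul_left, EuclideanSpace.inner_single_left]
  simp

/-- `∂_j a e_i - ∂_i a e_j` is divergence-free. -/
lemma curlField_mem {β : Eucl d → ℝ} (hβ : IsTest β) {g : Ω → ℝ} (hg : Measurable g)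
    {C : ℝ} (hC : ∀ ω, |g ω| ≤ C) {i j : Fin d} (hij : i ≠ j) :
    (fun ω => mol (pd j β) g ω • EuclideanSpace.single i (1 : ℝ) +
      (-mol (pd i β) g ω) • EuclideanSpace.single j (1 : ℝ)) ∈ smoothDivFree d Ω := by
  have hs1 := smoothBounded_mol (hβ.pd j) hg hC
  have hs2 := smoothBounded_mol (hβ.pd i) hg hC
  have hloc := locallyIntegrable_realisation_of_bound (d := d) hg hC
  have hS : SmoothBounded d (fun ω => mol (pd j β) g ω • EuclideanSpace.single i (1 : ℝ) +
      (-mol (pd i β) g ω) • EuclideanSpace.single j (1 : ℝ) : Ω → Eucl d) := by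
    have h1 := hs1.clm_comp
      (ContinuousLinearMap.toSpanSingleton ℝ (EuclideanSpace.single i (1 : ℝ) : Eucl d))
    have h2 := hs2.clm_comp
      (-ContinuousLinearMap.toSpanSingleton ℝ (EuclideanSpace.single j (1 : ℝ) : Eucl d))
    have h3 := h1.add h2
    simpa using h3
  refine ⟨?_, hS, fun ω => ?_⟩
  · exact ((measurable_mol (hβ.pd j).measurable hg).smul_const _).add
      ((measurable_mol (hβ.pd i).measurable hg).neg.smul_const _)
  · rw [divergence_eq_sum_cpd (hS.differentiable ω)]
    have hneg : ∀ (u : Ω → ℝ) (k : Fin d), cpd k (fun ω => -u ω) ω = - cpd k u ω := by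
      intro u k
      have : realisation (d := d) (fun ω => -u ω) ω = - realisation u ω := rfl
      rw [cpd, cpd, pd, pd, this, fderiv_neg]
      rfl
    have hzero : ∀ k : Fin d, cpd k (fun _ => (0 : ℝ)) ω = 0 := by
      intro k
      have : realisation (d := d) (fun _ : Ω => (0 : ℝ)) ω = fun _ => 0 := rfl
      simp [cpd, pd, this]
    -- Only the components `i` and `j` are nonzero, and their contributions cancel by symmetry of
    -- second derivatives.
    rw [← Finset.sum_subset (Finset.subset_univ {i, j}), Finset.sum_pair hij]
    · have e1 : (fun ω => (mol (pd j β) g ω • EuclideanSpace.single i (1 : ℝ) +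
          (-mol (pd i β) g ω) • EuclideanSpace.single j (1 : ℝ) : Eucl d) i) = mol (pd j β) g := by
        ext ω; simp [hij]
      have e2 : (fun ω => (mol (pd j β) g ω • EuclideanSpace.single i (1 : ℝ) +
          (-mol (pd i β) g ω) • EuclideanSpace.single j (1 : ℝ) : Eucl d) j) =
          fun ω => - mol (pd i β) g ω := by
        ext ω; simp [hij.symm]
      rw [e1, e2, hneg, cpd_mol (hβ.pd j) hloc, cpd_mol (hβ.pd i) hloc, pd_comm hβ]
      ring
    · intro k _ hk
      simp only [Finset.mem_insert, Finset.mem_singleton, not_or] at hk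
      have e3 : (fun ω => (mol (pd j β) g ω • EuclideanSpace.single i (1 : ℝ) +
          (-mol (pd i β) g ω) • EuclideanSpace.single j (1 : ℝ) : Eucl d) k) = fun _ => 0 := by
        ext ω; simp [hk.1, hk.2]
      rw [e3, hzero]

lemma pd_comp_neg_neg {α : Eucl d → ℝ} (hα : IsTest α) (j : Fin d) :
    (fun x => pd j (fun x => α (-x)) (-x)) = fun x => - pd j α x := by
  ext x
  rw [pd_comp_neg hα, neg_neg]

lemma integral_mol_pd_mul {α : Eucl d → ℝ} (hα : IsTest α) (j : Fin d)
    {f g : Ω → ℝ} (hfm : Measurable f) (hf : MemLp f 2 μ) (hgm : Measurable g)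
    (hg : MemLp g 2 μ) :
    ∫ ω, mol (pd j fun x => α (-x)) g ω * f ω ∂μ = - ∫ ω, g ω * mol (pd j α) f ω ∂μ := by
  rw [integral_mol_mul (hα.comp_neg.pd j) hgm hg hfm hf, pd_comp_neg_neg hα, mol_neg]
  simp [integral_neg]

lemma memLp_of_abs_le {g : Ω → ℝ} (hg : Measurable g) {C : ℝ} (hC : ∀ ω, |g ω| ≤ C)
    (p : ℝ≥0∞) : MemLp g p μ :=
  MemLp.of_bound hg.aestronglyMeasurable C (Eventually.of_forall hC)

/-- The mollified field is curl-free: orthogonality is tested on the curl fields built from the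
reflected kernel and an arbitrary bounded `g`, and passing to the adjoint puts `∂α` on the
components of `ψ`. -/
lemma mol_pd_symm_of_orthogonal (hψm : Measurable ψ) (hψ : MemLp ψ 2 μ)
    (h : ∀ s ∈ smoothDivFree d Ω, ∫ ω, inner ℝ (s ω) (ψ ω) ∂μ = 0)
    {α : Eucl d → ℝ} (hα : IsTest α) (i j : Fin d) :
    mol (pd j α) (fun ω => ψ ω i) =ᵐ[μ] mol (pd i α) (fun ω => ψ ω j) := by
  rcases eq_or_ne i j with rfl | hij
  · rfl
  have hm := fun i => measurable_component hψm i
  have hL := fun i => memLp_component hψ i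
  have hmm : ∀ i j, Measurable (mol (pd j α) fun ω => ψ ω i) :=
    fun i j => measurable_mol (hα.pd j).measurable (hm i)
  have hmL : ∀ i j, MemLp (mol (pd j α) fun ω => ψ ω i) 2 μ :=
    fun i j => memLp_mol (hα.pd j) (hm i) (hL i)
  have key : (mol (pd j α) fun ω => ψ ω i) - (mol (pd i α) fun ω => ψ ω j) =ᵐ[μ] 0 := by
    refine ae_eq_zero_of_forall_integral_mul ((hmm i j).sub (hmm j i))
      (((hmL i j).sub (hmL j i)).integrable one_le_two) fun g hg hg1 => ?_
    have hgL := memLp_of_abs_le (μ := μ) hg hg1 2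
    have h1 := h _ (curlField_mem hα.comp_neg hg hg1 hij)
    simp only [inner_add_left, inner_smul_single, neg_mul] at h1
    have hI : ∀ i j, Integrable (fun ω => mol (pd j fun x => α (-x)) g ω * ψ ω i) μ :=
      fun i j => integrable_mul_of_memLp_two (memLp_mol (hα.comp_neg.pd j) hg hgL) (hL i)
    rw [integral_add (hI i j) (hI j i).fun_neg, integral_neg, integral_mol_pd_mul hα j (hm i) (hL i)
      hg hgL, integral_mol_pd_mul hα i (hm j) (hL j) hg hgL] at h1
    simp only [Pi.sub_apply, mul_sub]
    rw [integral_sub (integrable_mul_of_memLp_two hgL (hmL i j)) (integrable_mul_of_memLp_two hgL (hmL j i))]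
    linarith
  filter_upwards [key] with ω hω
  exact sub_eq_zero.1 hω

/-- The mollified field is divergence-free: mollifications of bounded `g` lie in `Ds`, so their
gradients are admissible tests, and the adjoint again moves the kernel onto `ψ`. -/
lemma sum_mol_pd_eq_zero (hψ : ψ ∈ weakDivFree μ) {α : Eucl d → ℝ} (hα : IsTest α) :
    (fun ω => ∑ j, mol (pd j α) (fun ω => ψ ω j) ω) =ᵐ[μ] 0 := by
  obtain ⟨hψm, hψL, hdiv⟩ := hψ
  have hm := fun i => measurable_component hψm i
  have hL := fun i => memLp_component hψL i
  have hmL : ∀ i j, MemLp (mol (pd j α) fun ω => ψ ω i) 2 μ :=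
    fun i j => memLp_mol (hα.pd j) (hm i) (hL i)
  refine ae_eq_zero_of_forall_integral_mul
    (Finset.measurable_fun_sum _ fun j _ => measurable_mol (hα.pd j).measurable (hm j))
    (integrable_finsetSum _ fun j _ => (hmL j j).integrable one_le_two) fun g hg hg1 => ?_
  have hgL := memLp_of_abs_le (μ := μ) hg hg1 2
  have hS := smoothBounded_mol hα.comp_neg hg hg1
  have h1 := hdiv _ ⟨hS.mem_Dw (measurable_mol hα.comp_neg.measurable hg), hS⟩
  simp only [inner_classicalGrad] at h1
  simp only [cpd_mol hα.comp_neg (locallyIntegrable_realisation_of_bound hg hg1)] at h1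
  rw [integral_finsetSum _ fun j _ =>
    integrable_mul_of_memLp_two (memLp_mol (hα.comp_neg.pd j) hg hgL) (hL j)] at h1
  simp only [Finset.mul_sum]
  rw [integral_finsetSum _ fun j _ => integrable_mul_of_memLp_two hgL (hmL j j)]
  have h2 := fun j => integral_mol_pd_mul hα j (hm j) (hL j) hg hgL
  simp only [h2, Finset.sum_neg_distrib] at h1
  linarith

/-- The components of a weakly curl-free and divergence-free field are harmonic. -/
lemma sum_mol_pd_pd_eq_zero (hψ : ψ ∈ weakDivFree μ)
    (h : ∀ s ∈ smoothDivFree d Ω, ∫ ω, inner ℝ (s ω) (ψ ω) ∂μ = 0)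
    {α : Eucl d → ℝ} (hα : IsTest α) (i : Fin d) :
    (fun ω => ∑ j, mol (pd j (pd j α)) (fun ω => ψ ω i) ω) =ᵐ[μ] 0 := by
  have h1 : ∀ᵐ ω ∂μ, ∀ j, mol (pd j (pd j α)) (fun ω => ψ ω i) ω =
      mol (pd i (pd j α)) (fun ω => ψ ω j) ω :=
    ae_all_iff.2 fun j => mol_pd_symm_of_orthogonal hψ.1 hψ.2.1 h (hα.pd j) i j
  filter_upwards [h1, sum_mol_pd_eq_zero hψ (hα.pd i)] with ω h1 h2
  rw [← h2]
  refine Finset.sum_congr rfl fun j _ => ?_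
  rw [h1 j, pd_comm hα]

/-- A stationary square integrable harmonic function has vanishing gradient. -/
lemma mol_pd_eq_zero_of_harmonic {u : Ω → ℝ} (hum : Measurable u) (hu : MemLp u 2 μ)
    {α : Eucl d → ℝ} (hα : IsTest α) (hαe : ∀ x, α (-x) = α x)
    (h : (fun ω => ∑ j, mol (pd j (pd j α)) u ω) =ᵐ[μ] 0) (j : Fin d) :
    mol (pd j α) u =ᵐ[μ] 0 := by
  have hαe' : (fun x => α (-x)) = α := funext hαe
  have hw : ∀ j, Measurable (mol (pd j α) u) := fun j => measurable_mol (hα.pd j).measurable hum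
  have hwL : ∀ j, MemLp (mol (pd j α) u) 2 μ := fun j => memLp_mol (hα.pd j) hum hu
  have hv : ∀ j, Measurable (mol (pd j (pd j α)) u) :=
    fun j => measurable_mol ((hα.pd j).pd j).measurable hum
  have hvL : ∀ j, MemLp (mol (pd j (pd j α)) u) 2 μ :=
    fun j => memLp_mol ((hα.pd j).pd j) hum hu
  have hmα := memLp_mol (μ := μ) hα hum hu
  -- Integration by parts `E[(∂_j u_α)²] = -E[u_α ∂_j² u_α]` for the mollification `u_α`, carried
  -- out on kernels: one mollifier is moved off by the adjoint, the derivative is passed across, and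
  -- the mollifier is moved back. Evenness of `α` identifies it with its reflection.
  have key : ∀ j, ∫ ω, mol (pd j α) u ω * mol (pd j α) u ω ∂μ =
      - ∫ ω, mol α u ω * mol (pd j (pd j α)) u ω ∂μ := by
    intro j
    have h1 := integral_mol_pd_mul (μ := μ) hα j (hw j) (hwL j) hum hu
    rw [hαe'] at h1
    rw [h1]
    have h2 := integral_mol_mul (μ := μ) hα (hv j) (hvL j) hum hu
    rw [hαe'] at h2
    have h3 : ∫ ω, u ω * mol (pd j α) (mol (pd j α) u) ω ∂μ =
        ∫ ω, mol α (mol (pd j (pd j α)) u) ω * u ω ∂μ := by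
      refine integral_congr_ae ?_
      filter_upwards [ae_locallyIntegrable (d := d) hum (hu.integrable one_le_two)] with ω hω
      rw [mol_pd_mol hα (hα.pd j) hω j, mul_comm]
    rw [h3, h2]
    simp only [mul_comm]
  have hsum : ∑ j, ∫ ω, mol (pd j α) u ω * mol (pd j α) u ω ∂μ = 0 := by
    simp only [key, Finset.sum_neg_distrib, neg_eq_zero]
    rw [← integral_finsetSum _ fun j _ => integrable_mul_of_memLp_two hmα (hvL j)]
    rw [← integral_zero Ω ℝ (μ := μ)]
    refine integral_congr_ae ?_
    filter_upwards [h] with ω hω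
    rw [← Finset.mul_sum, show ∑ j, mol (pd j (pd j α)) u ω = 0 from hω, mul_zero]
  have hnn : ∀ j, 0 ≤ ∫ ω, mol (pd j α) u ω * mol (pd j α) u ω ∂μ :=
    fun j => integral_nonneg fun ω => mul_self_nonneg _
  have h0 := (Finset.sum_eq_zero_iff_of_nonneg fun j _ => hnn j).1 hsum j (Finset.mem_univ j)
  rw [integral_eq_zero_iff_of_nonneg (fun ω => mul_self_nonneg _)
    (integrable_mul_of_memLp_two (hwL j) (hwL j))] at h0
  filter_upwards [h0] with ω hω
  exact mul_self_eq_zero.1 hω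

/-- On almost every orbit the gradient vanishes almost everywhere, hence everywhere by continuity,
so the smooth realisation is constant. -/
lemma ae_realisation_mol_const {u : Ω → ℝ}
    (hloc : ∀ ω, LocallyIntegrable (realisation (d := d) u ω))
    {α : Eucl d → ℝ} (hα : IsTest α) (h : ∀ j, mol (pd j α) u =ᵐ[μ] 0) :
    ∀ᵐ ω ∂μ, ∀ x : Eucl d, mol α u (x +ᵥ ω) = mol α u ω := by
  have h1 : ∀ᵐ ω ∂μ, ∀ j, ∀ᵐ x : Eucl d, mol (pd j α) u (x +ᵥ ω) = 0 :=
    ae_all_iff.2 fun j => ae_ae_vadd (d := d) (p := fun ω => mol (pd j α) u ω = 0) (h j)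
  filter_upwards [h1] with ω hω x
  have h2 : ∀ j, pd j (realisation (d := d) (mol α u) ω) = fun _ => 0 := by
    intro j
    rw [pd_realisation_mol hα (hloc ω)]
    exact (Continuous.ae_eq_iff_eq volume
      (contDiff_realisation_mol (hα.pd j) (hloc ω)).continuous continuous_const).1 (hω j)
  have h3 : ∀ x, fderiv ℝ (realisation (d := d) (mol α u) ω) x = 0 := by
    intro x
    rw [fderiv_eq_sum_pd]
    simp [h2]
  have h4 := is_const_of_fderiv_eq_zero
    ((contDiff_realisation_mol hα (hloc ω)).differentiable (by simp)) h3 x 0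
  rwa [realisation_zero] at h4

/-- A square integrable function orthogonal to all bounded invariant functions has vanishing
mollification as soon as the gradient of the latter vanishes. -/
lemma mol_eq_zero_of_orthogonal_invariant {u : Ω → ℝ} (hum : Measurable u) (hu : MemLp u 2 μ)
    (hinv : ∀ (h : Ω → ℝ) (C : ℝ), Measurable h → (∀ ω, |h ω| ≤ C) →
      (∀ ω, ∀ x : Eucl d, h (x +ᵥ ω) = h ω) → ∫ ω, h ω * u ω ∂μ = 0)
    {α : Eucl d → ℝ} (hα : IsTest α) (h : ∀ j, mol (pd j α) u =ᵐ[μ] 0) :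
    mol α u =ᵐ[μ] 0 := by
  -- This version makes the mollification continuous along every orbit, not merely almost every one.
  obtain ⟨v, hvm, hvu, hvloc⟩ := exists_locallyIntegrable_version (d := d) hum
    (hu.integrable one_le_two)
  have hv : MemLp v 2 μ := (memLp_congr_ae hvu).2 hu
  have hconst := ae_realisation_mol_const (μ := μ) hvloc hα
    fun j => (mol_congr_ae _ hvu).trans (h j)
  set w := mol α v with hw
  have hwm : Measurable w := measurable_mol hα.measurable hvm
  have hwc : ∀ ω, Continuous (realisation (d := d) w ω) :=
    fun ω => (contDiff_realisation_mol hα (hvloc ω)).continuous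
  set G := {ω | ∀ x : Eucl d, w (x +ᵥ ω) = w ω} with hG
  have hGm : MeasurableSet G := by
    -- By continuity along orbits, countably many translations suffice.
    have : G = ⋂ n : ℕ, {ω | w (TopologicalSpace.denseSeq (Eucl d) n +ᵥ ω) = w ω} := by
      ext ω
      simp only [hG, Set.mem_ofPred_eq, Set.mem_iInter]
      refine ⟨fun h n => h _, fun h => ?_⟩
      have := Continuous.ext_on (TopologicalSpace.denseRange_denseSeq (Eucl d)) (hwc ω)
        (continuous_const (y := w ω)) (by rintro _ ⟨n, rfl⟩; exact h n)
      exact fun x => congrFun this x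
    rw [this]
    exact MeasurableSet.iInter fun n => measurableSet_eq_fun (measurable_comp_vadd hwm _) hwm
  have hGv : ∀ ω ∈ G, ∀ x : Eucl d, x +ᵥ ω ∈ G := by
    intro ω hω x z
    rw [← add_vadd, hω, hω]
  -- Cutting off at level `N` on the invariant set `G` keeps invariance and gives boundedness, so
  -- `1_A w` may be used as `h` in `hinv`.
  have hN : ∀ N : ℕ, ∀ᵐ ω ∂μ, ω ∈ G → |w ω| ≤ N → w ω = 0 := by
    intro N
    set A := G ∩ {ω | |w ω| ≤ N} with hA
    have hAm : MeasurableSet A := hGm.inter (measurableSet_le hwm.abs measurable_const)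
    have hAv : ∀ ω ∈ A, ∀ x : Eucl d, x +ᵥ ω ∈ A := by
      intro ω hω x
      refine ⟨hGv ω hω.1 x, ?_⟩
      have := hω.1 x
      simp only [Set.mem_ofPred_eq, this]
      exact hω.2
    have hAinv : ∀ ω, ∀ x : Eucl d, A.indicator w (x +ᵥ ω) = A.indicator w ω := by
      intro ω x
      by_cases hω : ω ∈ A
      · rw [Set.indicator_of_mem hω, Set.indicator_of_mem (hAv ω hω x), hω.1 x]
      · rw [Set.indicator_of_notMem hω, Set.indicator_of_notMem]
        intro hx
        exact hω (by simpa using hAv _ hx (-x))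
    have hAb : ∀ ω, |A.indicator w ω| ≤ N := by
      intro ω
      by_cases hω : ω ∈ A
      · rw [Set.indicator_of_mem hω]; exact hω.2
      · rw [Set.indicator_of_notMem hω]; simp
    have hAmeas : Measurable (A.indicator w) := hwm.indicator hAm
    have hAL := memLp_of_abs_le (μ := μ) hAmeas hAb 2
    have h1 := integral_mol_mul (μ := μ) hα hvm hv hAmeas hAL
    -- Mollifying an invariant function only multiplies it by the mass of the kernel. Thus `E[(1_A
    -- w)²]` is a multiple of `E[1_A w v] = 0`.
    have h2 : mol (fun x => α (-x)) (A.indicator w) = fun ω => (∫ t, α (-t)) * A.indicator w ω := by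
      ext ω
      simp only [mol, hAinv, integral_mul_const]
    have h3 : ∫ ω, v ω * mol (fun x => α (-x)) (A.indicator w) ω ∂μ = 0 := by
      have h4 : ∫ ω, A.indicator w ω * v ω ∂μ = 0 := by
        rw [← hinv _ N hAmeas hAb hAinv]
        refine integral_congr_ae ?_
        filter_upwards [hvu] with ω hω
        rw [hω]
      rw [h2]
      calc _ = ∫ ω, (∫ t, α (-t)) * (A.indicator w ω * v ω) ∂μ := by
            congr 1; ext ω; ring
        _ = 0 := by rw [integral_const_mul, h4, mul_zero]
    have h5 : ∀ ω, w ω * A.indicator w ω = A.indicator w ω * A.indicator w ω := by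
      intro ω
      by_cases hω : ω ∈ A
      · simp [hω]
      · simp [hω]
    rw [h3] at h1
    simp only [← hw, h5] at h1
    rw [integral_eq_zero_iff_of_nonneg (fun ω => mul_self_nonneg _) (integrable_mul_of_memLp_two hAL hAL)] at h1
    filter_upwards [h1] with ω hω hωG hωN
    have hωA : ω ∈ A := ⟨hωG, hωN⟩
    simpa [hωA] using hω
  have hvw : mol α u =ᵐ[μ] w := mol_congr_ae α hvu.symm
  filter_upwards [hvw, hconst, ae_all_iff.2 hN] with ω h1 h2 h3
  obtain ⟨N, hN⟩ := exists_nat_ge |w ω|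
  rw [h1]
  exact h3 N h2 hN

/-- A weakly divergence-free field which is orthogonal to all smooth divergence-free fields
vanishes. -/
lemma ae_eq_zero_of_orthogonal (hψ : ψ ∈ weakDivFree μ)
    (h : ∀ s ∈ smoothDivFree d Ω, ∫ ω, inner ℝ (s ω) (ψ ω) ∂μ = 0) : ψ =ᵐ[μ] 0 := by
  have hm := fun i => measurable_component hψ.1 i
  have hL := fun i => memLp_component hψ.2.1 i
  have hinv : ∀ (i : Fin d) (g : Ω → ℝ) (C : ℝ), Measurable g → (∀ ω, |g ω| ≤ C) →
      (∀ ω, ∀ x : Eucl d, g (x +ᵥ ω) = g ω) → ∫ ω, g ω * ψ ω i ∂μ = 0 := by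
    intro i g C hg hC hgi
    -- An invariant multiple of `e_i` is constant along each orbit, hence smooth and
    -- divergence-free. These fields take the place of ergodicity.
    have hmem : (fun ω => g ω • EuclideanSpace.single i (1 : ℝ)) ∈ smoothDivFree d Ω := by
      refine ⟨hg.smul_const _, ?_, fun ω => ?_⟩
      · refine SmoothBounded.of_realisation_const (C := C) (fun ω => ?_) fun ω x => ?_
        · rw [norm_smul, PiLp.norm_single, norm_one, mul_one]
          exact hC ω
        · rw [hgi]
      · have : realisation (d := d) (fun ω => (g ω • EuclideanSpace.single i (1 : ℝ) : Eucl d)) ω =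
            fun _ => g ω • EuclideanSpace.single i (1 : ℝ) := by
          ext1 x
          rw [realisation_apply, hgi]
        simp [divergence, this]
    have h1 := h _ hmem
    simpa only [inner_smul_single] using h1
  have hmol : ∀ i n, mol (approxId d n) (fun ω => ψ ω i) =ᵐ[μ] 0 := fun i n =>
    mol_eq_zero_of_orthogonal_invariant (hm i) (hL i) (hinv i) (isTest_approxId n) fun j =>
      mol_pd_eq_zero_of_harmonic (hm i) (hL i) (isTest_approxId n) (approxId_neg n)
        (sum_mol_pd_pd_eq_zero hψ h (isTest_approxId n) i) j
  have h1 : ∀ᵐ ω ∂μ, ∀ i, Tendsto (fun n => mol (approxId d n) (fun ω => ψ ω i) ω) atTop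
      (𝓝 (ψ ω i)) :=
    ae_all_iff.2 fun i => ae_tendsto_mol_approxId (hm i) ((hL i).integrable one_le_two)
  have h2 : ∀ᵐ ω ∂μ, ∀ i n, mol (approxId d n) (fun ω => ψ ω i) ω = 0 :=
    ae_all_iff.2 fun i => ae_all_iff.2 fun n => hmol i n
  filter_upwards [h1, h2] with ω h1 h2
  ext i
  have h3 := h1 i
  simp only [h2 i] at h3
  exact tendsto_nhds_unique h3 tendsto_const_nhds

end Orthogonal

end StationaryVar

namespace StationaryVar

variable {d : ℕ} {Ω : Type*} [AddAction (Eucl d) Ω]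

/-! ### Density of the smooth divergence-free fields in `L²`. -/

lemma divergence_add {φ ψ : Ω → Eucl d} {ω : Ω}
    (hφ : Differentiable ℝ (realisation (d := d) φ ω))
    (hψ : Differentiable ℝ (realisation (d := d) ψ ω)) :
    divergence (fun ω => φ ω + ψ ω) ω = divergence φ ω + divergence ψ ω := by
  have : realisation (d := d) (fun ω => φ ω + ψ ω) ω = realisation φ ω + realisation ψ ω := rfl
  simp only [divergence, this, fderiv_add (hφ 0) (hψ 0), add_apply, PiLp.add_apply,
    Finset.sum_add_distrib]

lemma divergence_smul (c : ℝ) {φ : Ω → Eucl d} {ω : Ω}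
    (hφ : Differentiable ℝ (realisation (d := d) φ ω)) :
    divergence (fun ω => c • φ ω) ω = c * divergence φ ω := by
  have : realisation (d := d) (fun ω => c • φ ω) ω = c • realisation φ ω := rfl
  simp only [divergence, this, fderiv_const_smul (hφ 0), smul_apply, PiLp.smul_apply,
    Finset.mul_sum, smul_eq_mul]

lemma divergence_const (c : Eucl d) (ω : Ω) : divergence (fun _ : Ω => c) ω = 0 := by
  have : realisation (d := d) (fun _ : Ω => c) ω = fun _ => c := rfl
  simp [divergence, this]

variable [MeasurableSpace Ω]

lemma add_mem_smoothDivFree {φ ψ : Ω → Eucl d} (hφ : φ ∈ smoothDivFree d Ω)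
    (hψ : ψ ∈ smoothDivFree d Ω) : (fun ω => φ ω + ψ ω) ∈ smoothDivFree d Ω := by
  refine ⟨hφ.1.add hψ.1, hφ.2.1.add hψ.2.1, fun ω => ?_⟩
  rw [divergence_add (hφ.2.1.differentiable ω) (hψ.2.1.differentiable ω), hφ.2.2, hψ.2.2, add_zero]

lemma smul_mem_smoothDivFree (c : ℝ) {φ : Ω → Eucl d} (hφ : φ ∈ smoothDivFree d Ω) :
    (fun ω => c • φ ω) ∈ smoothDivFree d Ω := by
  refine ⟨hφ.1.const_smul c, hφ.2.1.clm_comp (c • ContinuousLinearMap.id ℝ (Eucl d)), fun ω => ?_⟩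
  rw [divergence_smul c (hφ.2.1.differentiable ω), hφ.2.2, mul_zero]

lemma const_mem_smoothDivFree (c : Eucl d) : (fun _ => c) ∈ smoothDivFree d Ω :=
  ⟨measurable_const, SmoothBounded.of_realisation_const (C := ‖c‖) (fun _ => le_rfl)
    (fun _ _ => rfl), divergence_const c⟩

variable [MeasurableVAdd₂ (Eucl d) Ω]
variable {μ : Measure Ω} [IsProbabilityMeasure μ] [VAddInvariantMeasure (Eucl d) Ω μ]

variable (d μ) in
/-- The subspace of `L²` of the smooth divergence-free fields. -/
def smoothDivFreeLp : Submodule ℝ (Lp (Eucl d) 2 μ) where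
  carrier := {f | ∃ φ ∈ smoothDivFree d Ω, f =ᵐ[μ] φ}
  add_mem' := by
    rintro f g ⟨φ, hφ, hf⟩ ⟨ψ, hψ, hg⟩
    refine ⟨_, add_mem_smoothDivFree hφ hψ, ?_⟩
    filter_upwards [Lp.coeFn_add f g, hf, hg] with ω h1 h2 h3
    rw [h1, Pi.add_apply, h2, h3]
  zero_mem' := ⟨_, const_mem_smoothDivFree 0, Lp.coeFn_zero _ _ _⟩
  smul_mem' := by
    rintro c f ⟨φ, hφ, hf⟩
    refine ⟨_, smul_mem_smoothDivFree c hφ, ?_⟩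
    filter_upwards [Lp.coeFn_smul c f, hf] with ω h1 h2
    rw [h1, Pi.smul_apply, h2]

variable (d μ) in
/-- The subspace of `L²` spanned by the gradients of smooth functions. -/
noncomputable def gradientLp : Submodule ℝ (Lp (Eucl d) 2 μ) :=
  Submodule.span ℝ {f | ∃ w ∈ Ds d μ, f =ᵐ[μ] classicalGrad w}

lemma memLp_classicalGrad {w : Ω → ℝ} (hw : w ∈ Ds d μ) :
    MemLp (classicalGrad (d := d) w) 2 μ := by
  obtain ⟨C, hC⟩ := hw.2.exists_classicalGrad_le
  exact MemLp.of_bound (measurable_classicalGrad hw.1.1 hw.2).aestronglyMeasurable C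
    (Eventually.of_forall hC)

lemma mem_orthogonal_gradientLp {f : Lp (Eucl d) 2 μ} :
    f ∈ (gradientLp d μ)ᗮ ↔ ∀ w ∈ Ds d μ, ∫ ω, inner ℝ (classicalGrad w ω) (f ω) ∂μ = 0 := by
  have hinner : ∀ (g : Lp (Eucl d) 2 μ) (w : Ω → ℝ), g =ᵐ[μ] classicalGrad w →
      inner ℝ g f = ∫ ω, inner ℝ (classicalGrad w ω) (f ω) ∂μ := by
    intro g w hg
    rw [L2.inner_def]
    refine integral_congr_ae ?_
    filter_upwards [hg] with ω hω
    rw [hω]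
  rw [Submodule.mem_orthogonal]
  constructor
  · intro h w hw
    rw [← hinner _ w (memLp_classicalGrad hw).coeFn_toLp]
    exact h _ (Submodule.subset_span ⟨w, hw, (memLp_classicalGrad hw).coeFn_toLp⟩)
  · intro h g hg
    induction hg using Submodule.span_induction with
    | mem g hg =>
      obtain ⟨w, hw, hgw⟩ := hg
      rw [hinner g w hgw, h w hw]
    | zero => exact inner_zero_left _
    | add x y _ _ hx hy => rw [inner_add_left, hx, hy, add_zero]
    | smul c x _ hx => rw [real_inner_smul_left, hx, mul_zero]

/-- The smooth divergence-free fields are dense in the weakly divergence-free ones. -/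
lemma closure_smoothDivFreeLp :
    (smoothDivFreeLp d μ).topologicalClosure = (gradientLp d μ)ᗮ := by
  have hle : (smoothDivFreeLp d μ).topologicalClosure ≤ (gradientLp d μ)ᗮ := by
    refine Submodule.topologicalClosure_minimal _ ?_ (Submodule.isClosed_orthogonal _)
    rintro f ⟨φ, hφ, hf⟩
    rw [mem_orthogonal_gradientLp]
    intro w hw
    rw [← (smoothDivFree_subset (μ := μ) hφ).2.2 w hw]
    refine integral_congr_ae ?_
    filter_upwards [hf] with ω hω
    rw [hω]
  have : CompleteSpace (smoothDivFreeLp d μ).topologicalClosure :=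
    (Submodule.isClosed_topologicalClosure _).completeSpace_coe
  -- Elements of the second space are weakly divergence-free, so those also orthogonal to all smooth
  -- fields vanish. The closed subspace therefore fills `(gradientLp d μ)ᗮ`.
  have hbot : (smoothDivFreeLp d μ).topologicalClosureᗮ ⊓ (gradientLp d μ)ᗮ = ⊥ := by
    rw [eq_bot_iff]
    rintro f ⟨hf1, hf2⟩
    rw [Submodule.mem_bot]
    refine Lp.ext ?_
    refine EventuallyEq.trans ?_ (Lp.coeFn_zero _ _ _).symm
    refine ae_eq_zero_of_orthogonal
      ⟨(Lp.stronglyMeasurable f).measurable, Lp.memLp f, mem_orthogonal_gradientLp.1 hf2⟩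
      fun s hs => ?_
    have hsL := (smoothDivFree_subset (μ := μ) hs).2.1
    have h1 := (Submodule.mem_orthogonal _ _).1 hf1 (hsL.toLp s)
      (Submodule.le_topologicalClosure _ ⟨s, hs, hsL.coeFn_toLp⟩)
    rw [← h1, L2.inner_def]
    refine integral_congr_ae ?_
    filter_upwards [hsL.coeFn_toLp] with ω hω
    rw [hω]
  have := Submodule.sup_orthogonal_inf_of_hasOrthogonalProjection hle
  rwa [hbot, sup_bot_eq] at this

lemma exists_smoothDivFree_near {φ : Ω → Eucl d} (hφ : φ ∈ weakDivFree μ) {ε : ℝ≥0∞}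
    (hε : 0 < ε) : ∃ s ∈ smoothDivFree d Ω, eLpNorm (s - φ) 2 μ < ε := by
  have hmem : hφ.2.1.toLp φ ∈ closure (smoothDivFreeLp d μ : Set (Lp (Eucl d) 2 μ)) := by
    rw [← Submodule.topologicalClosure_coe, closure_smoothDivFreeLp, SetLike.mem_coe,
      mem_orthogonal_gradientLp]
    intro w hw
    refine Eq.trans (integral_congr_ae ?_) (hφ.2.2 w hw)
    filter_upwards [hφ.2.1.coeFn_toLp] with ω hω
    rw [hω]
  obtain ⟨f, ⟨s, hs, hfs⟩, hf⟩ := EMetric.mem_closure_iff.1 hmem ε hε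
  refine ⟨s, hs, ?_⟩
  rw [edist_comm, Lp.edist_def] at hf
  refine lt_of_eq_of_lt (eLpNorm_congr_ae ?_) hf
  filter_upwards [hfs, hφ.2.1.coeFn_toLp] with ω h1 h2
  simp [h1, h2]

lemma const_mem_PhiS (y : Eucl d) : (fun _ => y) ∈ PhiS (Ω := Ω) μ y := by
  have h := const_mem_smoothDivFree (Ω := Ω) y
  exact ⟨h.1, integrable_const y, h.2.1, by simp, h.2.2⟩

lemma PhiS_subset_PhiW (y : Eucl d) : PhiS μ y ⊆ PhiW (Ω := Ω) μ y := by
  rintro φ ⟨hm, -, hs, hy, hdiv⟩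
  have h := smoothDivFree_subset (μ := μ) ⟨hm, hs, hdiv⟩
  exact ⟨h.1, h.2.1, h.2.2, hy⟩

/-- `Φ_y^s ∈ 𝔓_y`. -/
theorem PhiS_mem_admissiblePhi (y : Eucl d) : PhiS μ y ∈ AdmissiblePhi (Ω := Ω) μ y := by
  refine ⟨PhiS_subset_PhiW y, fun φ hφ ε hε => ?_⟩
  have hε2 : 0 < ε / 2 := ENNReal.half_pos hε.ne'
  obtain ⟨s, hs, hsε⟩ := exists_smoothDivFree_near (μ := μ) ⟨hφ.1, hφ.2.1, hφ.2.2.1⟩ hε2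
  have hsL := (smoothDivFree_subset (μ := μ) hs).2.1
  have hsi := hsL.integrable one_le_two
  have hφi := hφ.2.1.integrable one_le_two
  -- The constant restoring the mean `y`. Its size is at most the `L¹` distance of `s` and `φ`,
  -- hence at most the `L²` distance; this is why `s` was chosen within `ε / 2`.
  set c := y - ∫ ω, s ω ∂μ with hc
  have hcn : ‖c‖ₑ ≤ eLpNorm (s - φ) 2 μ := by
    have h1 : c = - ∫ ω, (s - φ) ω ∂μ := by
      simp only [Pi.sub_apply]
      rw [integral_sub hsi hφi, hφ.2.2.2, neg_sub]
    rw [h1, enorm_neg]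
    refine (enorm_integral_le_lintegral_enorm _).trans ?_
    rw [← eLpNorm_one_eq_lintegral_enorm]
    exact eLpNorm_le_eLpNorm_of_exponent_le one_le_two (hsL.sub hφ.2.1).1
  have hmem := add_mem_smoothDivFree hs (const_mem_smoothDivFree c)
  refine ⟨fun ω => s ω + c, ⟨hmem.1, hsi.add (integrable_const c), hmem.2.1, ?_, hmem.2.2⟩, ?_⟩
  · rw [integral_add hsi (integrable_const c)]
    simp [hc]
  · have h1 : (fun ω => s ω + c) - φ = (s - φ) + fun _ => c := by
      ext1 ω
      simp only [Pi.sub_apply, Pi.add_apply]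
      abel
    rw [h1]
    refine (eLpNorm_add_le (hsL.sub hφ.2.1).1 aestronglyMeasurable_const one_le_two).trans_lt ?_
    have h2 : eLpNorm (fun _ : Ω => c) 2 μ = ‖c‖ₑ := by
      rw [eLpNorm_const _ two_ne_zero (NeZero.ne μ)]
      simp
    rw [h2]
    calc _ < ε / 2 + ε / 2 := ENNReal.add_lt_add hsε (hcn.trans_lt hsε)
      _ = ε := ENNReal.add_halves ε

/-! ### Approximation of densities -/

omit [MeasurableVAdd₂ (Eucl d) Ω] [IsProbabilityMeasure μ] [VAddInvariantMeasure (Eucl d) Ω μ]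
  [AddAction (Eucl d) Ω] in
lemma exists_ae_norm_le {E : Type*} [NormedAddCommGroup E] {f : Ω → E} (hf : MemLp f ⊤ μ) :
    ∃ C : ℝ, ∀ᵐ ω ∂μ, ‖f ω‖ ≤ C := by
  have h := hf.2
  rw [eLpNorm_exponent_top] at h
  refine ⟨(eLpNormEssSup f μ).toReal, ?_⟩
  filter_upwards [enorm_ae_le_eLpNormEssSup f μ] with ω hω
  rw [← toReal_enorm]
  exact ENNReal.toReal_mono h.ne hω

omit [MeasurableVAdd₂ (Eucl d) Ω] [IsProbabilityMeasure μ] [VAddInvariantMeasure (Eucl d) Ω μ]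
  [AddAction (Eucl d) Ω] in
lemma eLpNorm_two_eq {E : Type*} [NormedAddCommGroup E] {f : Ω → E} (hf : MemLp f 2 μ) :
    eLpNorm f 2 μ = ENNReal.ofReal (Real.sqrt (∫ ω, ‖f ω‖ ^ 2 ∂μ)) := by
  rw [hf.eLpNorm_eq_integral_rpow_norm two_ne_zero ENNReal.ofNat_ne_top, Real.sqrt_eq_rpow]
  simp

/-- Clamping `g` to `[-C, C]` turns the almost sure bound into a pointwise one, which a nonnegative
kernel of mass one preserves. -/
lemma ae_abs_mol_approxId_le {g : Ω → ℝ} {C : ℝ} (hC : ∀ᵐ ω ∂μ, |g ω| ≤ C)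
    (n : ℕ) : ∀ᵐ ω ∂μ, |mol (approxId d n) g ω| ≤ C := by
  have hC0 : 0 ≤ C := by
    obtain ⟨ω, hω⟩ := hC.exists
    exact (abs_nonneg _).trans hω
  have hcl : (fun ω => max (-C) (min (g ω) C)) =ᵐ[μ] g := by
    filter_upwards [hC] with ω hω
    rw [min_eq_left (abs_le.1 hω).2, max_eq_right (abs_le.1 hω).1]
  filter_upwards [mol_congr_ae (d := d) (approxId d n) hcl] with ω hω
  rw [← hω]
  have h := abs_mol_le (isTest_approxId (d := d) n).integrable
    (f := fun ω => max (-C) (min (g ω) C)) (C := C) (fun ω => abs_le.2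
      ⟨le_max_left _ _, max_le (by linarith) (min_le_right _ _)⟩) ω
  simpa only [abs_of_nonneg (approxId_nonneg _ _), integral_approxId, one_mul] using h

lemma tendsto_eLpNorm_mol_approxId {g : Ω → ℝ} (hg : Measurable g) {C : ℝ}
    (hC : ∀ᵐ ω ∂μ, |g ω| ≤ C) :
    Tendsto (fun n => eLpNorm (mol (approxId d n) g - g) 2 μ) atTop (𝓝 0) := by
  have hgi : MemLp g 2 μ := MemLp.of_bound hg.aestronglyMeasurable C hC
  have hmm : ∀ n, Measurable (mol (approxId d n) g) :=
    fun n => measurable_mol (isTest_approxId n).measurable hg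
  have hint : Tendsto (fun n => ∫ ω, ‖(mol (approxId d n) g - g) ω‖ ^ 2 ∂μ) atTop (𝓝 0) := by
    rw [← integral_zero Ω ℝ (μ := μ)]
    refine tendsto_integral_of_dominated_convergence (fun _ => (C + C) ^ 2)
      (fun n => (((hmm n).sub hg).norm.pow_const 2).aestronglyMeasurable) (integrable_const _)
      (fun n => ?_) ?_
    · filter_upwards [hC, ae_abs_mol_approxId_le (d := d) hC n] with ω h1 h2
      rw [Real.norm_of_nonneg (by positivity)]
      refine pow_le_pow_left₀ (norm_nonneg _) ?_ 2
      exact (norm_sub_le _ _).trans (add_le_add h2 h1)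
    · filter_upwards [ae_tendsto_mol_approxId (d := d) hg (hgi.integrable one_le_two)] with ω hω
      have h1 : Tendsto (fun n => mol (approxId d n) g ω - g ω) atTop (𝓝 0) := by
        simpa using hω.sub_const (g ω)
      simpa using (h1.norm.pow 2)
  have heq : ∀ n, eLpNorm (mol (approxId d n) g - g) 2 μ =
      ENNReal.ofReal (Real.sqrt (∫ ω, ‖(mol (approxId d n) g - g) ω‖ ^ 2 ∂μ)) :=
    fun n => eLpNorm_two_eq ((memLp_mol (isTest_approxId n) hg hgi).sub hgi)
  simp only [heq]
  have := (ENNReal.continuous_ofReal.comp Real.continuous_sqrt).tendsto 0 |>.comp hint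
  simpa [Function.comp_def] using this

lemma Fs_subset_Fw : Fs d μ ⊆ Fw (Ω := Ω) d μ := by
  rintro f ⟨hm, -, hs, h1, c, hc, hcf⟩
  obtain ⟨C, hC⟩ := hs.exists_norm_le
  obtain ⟨K, hK⟩ := hs.exists_cpd_le
  refine ⟨hs.mem_Dw hm, h1, ⟨c / 2, by linarith, Eventually.of_forall fun ω => ?_⟩,
    MemLp.of_bound hm.aestronglyMeasurable C (Eventually.of_forall hC), fun i => ?_⟩
  · have := hcf ω
    linarith
  · have hw := hs.hasWeakPartial (μ := μ) hm i
    refine (memLp_congr_ae hw.weakPartial_ae_eq).2 ?_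
    exact MemLp.of_bound hw.1.aestronglyMeasurable K (Eventually.of_forall (hK i))

/-- `𝔽_s ∈ 𝔉`. -/
theorem Fs_mem_admissibleF : Fs d μ ∈ AdmissibleF (Ω := Ω) d μ := by
  refine ⟨Fs_subset_Fw, fun f hf => ?_⟩
  obtain ⟨⟨hfm, hfL, hfw⟩, hf1, ⟨c, hc, hcf⟩, hfb, hfwb⟩ := hf
  obtain ⟨C, hC⟩ := exists_ae_norm_le hfb
  have hcC : c ≤ C := by
    obtain ⟨ω, h1, h2⟩ := (hcf.and hC).exists
    exact h1.le.trans ((le_abs_self _).trans h2)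
  -- Membership in `Fs` demands bounds at every `ω`, while `f` obeys its bounds only almost surely;
  -- the clamped version obeys them everywhere.
  set f' : Ω → ℝ := fun ω => max c (min (f ω) C) with hf'
  have hf'm : Measurable f' := measurable_const.max (hfm.min measurable_const)
  have hff' : f' =ᵐ[μ] f := by
    filter_upwards [hcf, hC] with ω h1 h2
    rw [hf']
    dsimp only
    rw [min_eq_left ((le_abs_self _).trans h2), max_eq_right h1.le]
  have hf'b : ∀ ω, |f' ω| ≤ C := fun ω => abs_le.2
    ⟨by linarith [le_max_left c (min (f ω) C)], max_le hcC (min_le_right _ _)⟩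
  have hf'L := memLp_of_abs_le (μ := μ) hf'm hf'b 2
  have hsm : ∀ n, SmoothBounded d (mol (approxId d n) f') :=
    fun n => smoothBounded_mol (isTest_approxId n) hf'm hf'b
  have hmm : ∀ n, Measurable (mol (approxId d n) f') :=
    fun n => measurable_mol (isTest_approxId n).measurable hf'm
  have hlow : ∀ n ω, c ≤ mol (approxId d n) f' ω := by
    intro n ω
    have h1 : ∫ t, approxId d n t * c = c := by
      rw [integral_mul_const, integral_approxId, one_mul]
    have hI := (isTest_approxId (d := d) n).integrable
    rw [mol, ← h1]
    refine integral_mono (hI.mul_const c) ?_ fun t =>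
      mul_le_mul_of_nonneg_left (le_max_left _ _) (approxId_nonneg n t)
    exact hI.mul_bdd (c := C)
      (hf'm.comp (measurable_id.neg.vadd measurable_const)).aestronglyMeasurable
      (Eventually.of_forall fun t => hf'b _)
  -- The mollifications are only known to be `≥ c`; the value `c / 2` gives the strict inequality in
  -- `AdmissibleF`.
  refine ⟨fun n => mol (approxId d n) f', c / 2, fun n => ⟨hmm n, ?_, hsm n, ?_, c, hc, hlow n⟩,
    by linarith, ?_, Eventually.of_forall fun ω n => by linarith [hlow n ω]⟩
  · obtain ⟨K, hK⟩ := (hsm n).exists_norm_le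
    exact integrable_of_bound (hmm n).aestronglyMeasurable hK
  · rw [integral_mol (isTest_approxId n) hf'm hf'L, integral_approxId, one_mul,
      integral_congr_ae hff', hf1]
  · have h0 : Tendsto (fun n => eLpNorm (mol (approxId d n) f' - f) 2 μ) atTop (𝓝 0) := by
      have hCf : ∀ᵐ ω ∂μ, |f ω| ≤ C := hC
      refine (tendsto_eLpNorm_mol_approxId (d := d) hfm hCf).congr fun n => eLpNorm_congr_ae ?_
      filter_upwards [mol_congr_ae (d := d) (approxId d n) hff'] with ω h1
      simp [h1]
    have hi : ∀ i : Fin d, Tendsto (fun n => eLpNorm (weakPartial μ i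
        (mol (approxId d n) f' - f)) 2 μ) atTop (𝓝 0) := by
      intro i
      obtain ⟨K, hK⟩ := exists_ae_norm_le (hfwb i)
      have hw := hasWeakPartial_weakPartial (hfw i).1
      refine (tendsto_eLpNorm_mol_approxId (d := d) hw.1 hK).congr fun n => eLpNorm_congr_ae ?_
      have hα := isTest_approxId (d := d) n
      have h1 := (hsm n).hasWeakPartial (μ := μ) (hmm n) i
      have h2 := (h1.sub hw).weakPartial_ae_eq
      rw [cpd_mol hα (locallyIntegrable_realisation_of_bound hf'm hf'b)] at h2
      -- Mollification commutes with the weak derivative, so the convergence for the bounded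
      -- function `∂_i f` applies.
      filter_upwards [h2, mol_congr_ae (pd i (approxId d n)) hff', mol_pd_ae_eq hα hw]
        with ω h2 h3 h4
      rw [h2, Pi.sub_apply, Pi.sub_apply, h3, h4]
    have := h0.add (tendsto_finsetSum Finset.univ fun i _ => hi i)
    simpa [nablaNorm] using this

end StationaryVar

namespace StationaryVar

section MeasureSpace

variable {Ω : Type*} [MeasurableSpace Ω] {μ : Measure Ω} [IsProbabilityMeasure μ]

/-! ### Square integrable functions -/

lemma integral_abs_mul_le_sqrt {f g : Ω → ℝ} (hf : MemLp f 2 μ) (hg : MemLp g 2 μ) :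
    ∫ ω, |f ω| * |g ω| ∂μ ≤ Real.sqrt (∫ ω, f ω ^ 2 ∂μ) * Real.sqrt (∫ ω, g ω ^ 2 ∂μ) := by
  have h := integral_mul_norm_le_Lp_mul_Lq (μ := μ) Real.HolderConjugate.two_two (f := f) (g := g)
    (by simpa using hf) (by simpa using hg)
  simpa [Real.sqrt_eq_rpow] using h

lemma integral_abs_le_sqrt {f : Ω → ℝ} (hf : MemLp f 2 μ) :
    ∫ ω, |f ω| ∂μ ≤ Real.sqrt (∫ ω, f ω ^ 2 ∂μ) := by
  have h := integral_abs_mul_le_sqrt hf (memLp_const (1 : ℝ))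
  simpa using h

lemma tendsto_integral_sq {h : ℕ → Ω → ℝ} (hL : ∀ n, MemLp (h n) 2 μ)
    (ht : Tendsto (fun n => eLpNorm (h n) 2 μ) atTop (𝓝 0)) :
    Tendsto (fun n => ∫ ω, h n ω ^ 2 ∂μ) atTop (𝓝 0) := by
  have h1 : ∀ n, (eLpNorm (h n) 2 μ).toReal ^ 2 = ∫ ω, h n ω ^ 2 ∂μ := by
    intro n
    rw [eLpNorm_two_eq (hL n), ENNReal.toReal_ofReal (Real.sqrt_nonneg _), Real.sq_sqrt
      (integral_nonneg fun ω => by positivity)]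
    simp
  simp only [← h1]
  have h2 := (ENNReal.tendsto_toReal ENNReal.zero_ne_top).comp ht
  simpa using h2.pow 2

lemma integral_norm_sq_le_of_eLpNorm_lt {E : Type*} [NormedAddCommGroup E] {h : Ω → E}
    (hL : MemLp h 2 μ) {ε : ℝ} (hε : 0 ≤ ε)
    (hlt : eLpNorm h 2 μ < ENNReal.ofReal (Real.sqrt ε)) : ∫ ω, ‖h ω‖ ^ 2 ∂μ ≤ ε := by
  rw [eLpNorm_two_eq hL] at hlt
  have h1 := (ENNReal.ofReal_lt_ofReal_iff_of_nonneg (Real.sqrt_nonneg _)).1 hlt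
  exact (Real.sqrt_le_sqrt_iff hε).1 h1.le

end MeasureSpace

variable {d : ℕ} {Ω : Type*} [MeasurableSpace Ω]

/-- The flux energy `∫ |φ|²/(2f)`. -/
noncomputable def fluxEnergy (μ : Measure Ω) (f : Ω → ℝ) (φ : Ω → Eucl d) : ℝ :=
  ∫ ω, ‖φ ω‖ ^ 2 / (2 * f ω) ∂μ

/-- The density energy `∫ |∇f|²/(8f) + V f`. -/
noncomputable def densityEnergy (μ : Measure Ω) (grad : (Ω → ℝ) → Ω → Eucl d) (V f : Ω → ℝ) : ℝ :=
  ∫ ω, (‖grad f ω‖ ^ 2 / (8 * f ω) + V ω * f ω) ∂μ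

lemma variationalValue_eq (μ : Measure Ω) (grad : (Ω → ℝ) → Ω → Eucl d) (V : Ω → ℝ)
    (F : Set (Ω → ℝ)) (Φ : Set (Ω → Eucl d)) :
    variationalValue μ grad V F Φ =
      2 * ⨅ f : F, Real.sqrt (densityEnergy μ grad V f.1 * ⨅ φ : Φ, fluxEnergy μ f.1 φ.1) := rfl

/-! ### The flux energy as a function of the field and of the density. -/

section Flux

variable {μ : Measure Ω} [IsProbabilityMeasure μ]

lemma fluxEnergy_nonneg {f : Ω → ℝ} {c : ℝ} (hc : 0 < c) (hf : ∀ᵐ ω ∂μ, c ≤ f ω)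
    (φ : Ω → Eucl d) : 0 ≤ fluxEnergy μ f φ := by
  refine integral_nonneg_of_ae ?_
  filter_upwards [hf] with ω hω
  have : 0 < f ω := hc.trans_le hω
  show 0 ≤ ‖φ ω‖ ^ 2 / (2 * f ω)
  positivity

lemma ciInf_fluxEnergy_nonneg {f : Ω → ℝ} {c : ℝ} (hc : 0 < c) (hf : ∀ᵐ ω ∂μ, c ≤ f ω)
    (Φ : Set (Ω → Eucl d)) : 0 ≤ ⨅ φ : Φ, fluxEnergy μ f φ.1 :=
  Real.iInf_nonneg fun φ => fluxEnergy_nonneg hc hf φ.1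

lemma bddBelow_fluxEnergy {f : Ω → ℝ} {c : ℝ} (hc : 0 < c) (hf : ∀ᵐ ω ∂μ, c ≤ f ω)
    (Φ : Set (Ω → Eucl d)) : BddBelow (Set.range fun φ : Φ => fluxEnergy μ f φ.1) := by
  refine ⟨0, ?_⟩
  rintro _ ⟨φ, rfl⟩
  exact fluxEnergy_nonneg hc hf φ.1

lemma integrable_flux {f : Ω → ℝ} (hfm : Measurable f) {c : ℝ} (hc : 0 < c)
    (hf : ∀ᵐ ω ∂μ, c ≤ f ω) {φ : Ω → Eucl d} (hφ : MemLp φ 2 μ) :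
    Integrable (fun ω => ‖φ ω‖ ^ 2 / (2 * f ω)) μ := by
  have h2 : Integrable (fun ω => ‖φ ω‖ ^ 2) μ := hφ.integrable_norm_pow two_ne_zero
  simp only [div_eq_mul_inv]
  refine h2.mul_bdd (c := (2 * c)⁻¹) (hfm.const_mul 2).inv.aestronglyMeasurable ?_
  filter_upwards [hf] with ω hω
  have : 0 < f ω := hc.trans_le hω
  rw [norm_inv, Real.norm_of_nonneg (by positivity)]
  exact inv_anti₀ (by positivity) (by linarith)

/-- Young's inequality `(p + r)² ≤ (1 + δ) p² + (1 + 1/δ) r²`, with the lower bound on `f` used only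
in the error term. -/
lemma fluxEnergy_le {f : Ω → ℝ} (hfm : Measurable f) {c : ℝ} (hc : 0 < c)
    (hf : ∀ᵐ ω ∂μ, c ≤ f ω) {φ ψ : Ω → Eucl d} (hφ : MemLp φ 2 μ) (hψ : MemLp ψ 2 μ) {δ : ℝ}
    (hδ : 0 < δ) :
    fluxEnergy μ f ψ ≤ (1 + δ) * fluxEnergy μ f φ +
      (1 + 1 / δ) * ((2 * c)⁻¹ * ∫ ω, ‖(ψ - φ) ω‖ ^ 2 ∂μ) := by
  have hD : Integrable (fun ω => ‖(ψ - φ) ω‖ ^ 2) μ := (hψ.sub hφ).integrable_norm_pow two_ne_zero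
  rw [fluxEnergy, fluxEnergy, ← integral_const_mul, ← integral_const_mul, ← integral_const_mul,
    ← integral_add ((integrable_flux hfm hc hf hφ).const_mul _) ((hD.const_mul _).const_mul _)]
  refine integral_mono_ae (integrable_flux hfm hc hf hψ)
    (((integrable_flux hfm hc hf hφ).const_mul _).add ((hD.const_mul _).const_mul _)) ?_
  filter_upwards [hf] with ω hω
  have hpos : 0 < f ω := hc.trans_le hω
  have h1 : ‖ψ ω‖ ≤ ‖φ ω‖ + ‖(ψ - φ) ω‖ := by
    have := norm_add_le (φ ω) ((ψ - φ) ω)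
    simpa using this
  set a := ‖ψ ω‖
  set p := ‖φ ω‖
  set r := ‖(ψ - φ) ω‖
  have hp : 0 ≤ p := norm_nonneg _
  have hr : 0 ≤ r := norm_nonneg _
  have h2 : a ^ 2 ≤ (1 + δ) * p ^ 2 + (1 + 1 / δ) * r ^ 2 := by
    have h3 : a ^ 2 ≤ (p + r) ^ 2 := pow_le_pow_left₀ (norm_nonneg _) h1 2
    have h4 : 2 * p * r ≤ δ * p ^ 2 + 1 / δ * r ^ 2 := by
      have h5 : 0 ≤ (δ * p - r) ^ 2 / δ := by positivity
      have h6 : (δ * p - r) ^ 2 / δ = δ * p ^ 2 + 1 / δ * r ^ 2 - 2 * p * r := by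
        field_simp
        ring
      linarith
    nlinarith
  have h7 : r ^ 2 / (2 * f ω) ≤ (2 * c)⁻¹ * r ^ 2 := by
    rw [div_eq_inv_mul]
    exact mul_le_mul_of_nonneg_right (inv_anti₀ (by positivity) (by linarith)) (by positivity)
  calc a ^ 2 / (2 * f ω) ≤ ((1 + δ) * p ^ 2 + (1 + 1 / δ) * r ^ 2) / (2 * f ω) := by gcongr
    _ = (1 + δ) * (p ^ 2 / (2 * f ω)) + (1 + 1 / δ) * (r ^ 2 / (2 * f ω)) := by ring
    _ ≤ _ := by gcongr

variable [AddAction (Eucl d) Ω] [MeasurableVAdd₂ (Eucl d) Ω] [VAddInvariantMeasure (Eucl d) Ω μ]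

/-- The minimal flux energy is the same over all dense sets of divergence-free fields. -/
lemma ciInf_fluxEnergy_eq {f : Ω → ℝ} (hfm : Measurable f) {c : ℝ} (hc : 0 < c)
    (hf : ∀ᵐ ω ∂μ, c ≤ f ω) {y : Eucl d} {Φ : Set (Ω → Eucl d)} (hΦ : Φ ∈ AdmissiblePhi μ y) :
    ⨅ φ : Φ, fluxEnergy μ f φ.1 = ⨅ φ : PhiW μ y, fluxEnergy μ f φ.1 := by
  have hW : (fun _ => y) ∈ PhiW (Ω := Ω) μ y := PhiS_subset_PhiW y (const_mem_PhiS y)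
  -- The constant field `y` rules out empty index sets, over which a real infimum takes the default
  -- value `0`.
  have : Nonempty (PhiW (Ω := Ω) μ y) := ⟨⟨_, hW⟩⟩
  have : Nonempty Φ := by
    obtain ⟨ψ, hψ, -⟩ := hΦ.2 _ hW 1 one_pos
    exact ⟨⟨ψ, hψ⟩⟩
  refine le_antisymm (le_ciInf fun φ => ?_) (le_ciInf fun φ =>
    ciInf_le (bddBelow_fluxEnergy hc hf _) (⟨φ.1, hΦ.1 φ.2⟩ : PhiW (Ω := Ω) μ y))
  have hφL := φ.2.2.1
  have hδ : ∀ δ : ℝ, 0 < δ → ⨅ φ : Φ, fluxEnergy μ f φ.1 ≤ (1 + δ) * fluxEnergy μ f φ.1 + δ := by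
    intro δ hδ
    -- The factor in front of the error in `fluxEnergy_le`; choosing `ψ` within `√(δ / A)` of `φ`
    -- makes the error at most `δ`.
    set A := (1 + 1 / δ) * (2 * c)⁻¹ with hA
    have hApos : 0 < A := by positivity
    obtain ⟨ψ, hψ, hψε⟩ := hΦ.2 φ.1 φ.2 (ENNReal.ofReal (Real.sqrt (δ / A)))
      (ENNReal.ofReal_pos.2 (Real.sqrt_pos.2 (by positivity)))
    have hψL := (hΦ.1 hψ).2.1
    have h1 := integral_norm_sq_le_of_eLpNorm_lt (hψL.sub hφL) (by positivity) hψε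
    refine (ciInf_le (bddBelow_fluxEnergy hc hf _) (⟨ψ, hψ⟩ : Φ)).trans ?_
    refine (fluxEnergy_le hfm hc hf hφL hψL hδ).trans ?_
    rw [← mul_assoc, ← hA]
    have h2 : A * ∫ ω, ‖(ψ - φ.1) ω‖ ^ 2 ∂μ ≤ δ := by
      calc _ ≤ A * (δ / A) := mul_le_mul_of_nonneg_left h1 hApos.le
        _ = δ := by field_simp
    linarith
  have hlim : Tendsto (fun δ : ℝ => (1 + δ) * fluxEnergy μ f φ.1 + δ) (𝓝[>] 0)
      (𝓝 (fluxEnergy μ f φ.1)) := by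
    have : Continuous fun δ : ℝ => (1 + δ) * fluxEnergy μ f φ.1 + δ := by fun_prop
    have h := (this.tendsto 0).mono_left (nhdsWithin_le_nhds (s := Set.Ioi (0 : ℝ)))
    simpa using h
  exact ge_of_tendsto hlim (eventually_mem_nhdsWithin.mono fun δ h => hδ δ h)

/-- For a bounded field, the flux energy is continuous in the density. -/
lemma tendsto_fluxEnergy {u : ℕ → Ω → ℝ} {f : Ω → ℝ} (hum : ∀ n, Measurable (u n))
    (hfm : Measurable f) {c : ℝ} (hc : 0 < c) (hu : ∀ n, ∀ᵐ ω ∂μ, c ≤ u n ω)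
    (hf : ∀ᵐ ω ∂μ, c ≤ f ω) (hL : ∀ n, MemLp (u n - f) 2 μ)
    (ht : Tendsto (fun n => ∫ ω, (u n - f) ω ^ 2 ∂μ) atTop (𝓝 0)) {φ : Ω → Eucl d}
    (hφm : Measurable φ) {K : ℝ} (hK : ∀ ω, ‖φ ω‖ ≤ K) :
    Tendsto (fun n => fluxEnergy μ (u n) φ) atTop (𝓝 (fluxEnergy μ f φ)) := by
  have hφL : MemLp φ 2 μ := MemLp.of_bound hφm.aestronglyMeasurable K (Eventually.of_forall hK)
  rw [tendsto_iff_norm_sub_tendsto_zero]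
  -- The constant bounds `|φ|² / (2 u_n f)`, the factor of `f - u_n` in the difference of the
  -- integrands; the root bounds the `L¹` norm of `u_n - f`.
  have hlim : Tendsto (fun n => K ^ 2 / (2 * c ^ 2) * Real.sqrt (∫ ω, (u n - f) ω ^ 2 ∂μ))
      atTop (𝓝 0) := by
    have := ((Real.continuous_sqrt.tendsto 0).comp ht).const_mul (K ^ 2 / (2 * c ^ 2))
    simpa [Function.comp_def] using this
  refine squeeze_zero (fun n => norm_nonneg _) (fun n => ?_) hlim
  rw [fluxEnergy, fluxEnergy, ← integral_sub (integrable_flux (hum n) hc (hu n) hφL)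
    (integrable_flux hfm hc hf hφL)]
  refine le_trans ?_ (mul_le_mul_of_nonneg_left (integral_abs_le_sqrt (hL n)) (by positivity))
  rw [← integral_const_mul]
  refine norm_integral_le_of_norm_le
    (((hL n).integrable one_le_two).abs.const_mul _) ?_
  filter_upwards [hu n, hf] with ω h1 h2
  have h1' : 0 < u n ω := hc.trans_le h1
  have h2' : 0 < f ω := hc.trans_le h2
  have h3 : ‖φ ω‖ ^ 2 / (2 * u n ω) - ‖φ ω‖ ^ 2 / (2 * f ω) =
      ‖φ ω‖ ^ 2 / (2 * (u n ω * f ω)) * (f ω - u n ω) := by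
    field_simp
  rw [h3, norm_mul, Real.norm_of_nonneg (by positivity), Pi.sub_apply, abs_sub_comm,
    Real.norm_eq_abs]
  refine mul_le_mul_of_nonneg_right ?_ (abs_nonneg _)
  have h4 : c ^ 2 ≤ u n ω * f ω := by
    rw [sq]; exact mul_le_mul h1 h2 hc.le h1'.le
  have h5 : ‖φ ω‖ ^ 2 ≤ K ^ 2 := pow_le_pow_left₀ (norm_nonneg _) (hK ω) 2
  exact div_le_div₀ (by positivity) h5 (by positivity) (by linarith)

end Flux

/-! ### Continuity of the density energy. -/

section Density

variable {μ : Measure Ω} [IsProbabilityMeasure μ]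

/-- Numerator and denominator are varied separately, with `p² - q² = (p - q)² + 2q(p - q)`. Only
`q`, the gradient of the limit, has to be bounded: the approximating gradients have no uniform
bound. -/
lemma abs_div_sub_div_le {p q r u f c K : ℝ} (hc : 0 < c) (hu : c ≤ u) (hf : c ≤ f)
    (hq : 0 ≤ q) (hqK : q ≤ K) (hpq : |p - q| ≤ r) :
    |p ^ 2 / (8 * u) - q ^ 2 / (8 * f)| ≤
      (8 * c)⁻¹ * (r ^ 2 + 2 * K * r) + K ^ 2 / (8 * c ^ 2) * |u - f| := by
  have hu0 : 0 < u := hc.trans_le hu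
  have hf0 : 0 < f := hc.trans_le hf
  have hr : 0 ≤ r := (abs_nonneg _).trans hpq
  have h1 : p ^ 2 / (8 * u) - q ^ 2 / (8 * f) =
      (8 * u)⁻¹ * (p ^ 2 - q ^ 2) + q ^ 2 / (8 * (u * f)) * (f - u) := by
    field_simp
    ring
  have h2 : |p ^ 2 - q ^ 2| ≤ r ^ 2 + 2 * K * r := by
    have h3 : p ^ 2 - q ^ 2 = (p - q) * (p - q) + 2 * q * (p - q) := by ring
    rw [h3]
    refine (abs_add_le _ _).trans ?_
    rw [abs_mul, abs_mul, abs_of_nonneg (by positivity : 0 ≤ 2 * q)]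
    have h4 : |p - q| * |p - q| ≤ r ^ 2 := by
      rw [sq]; exact mul_le_mul hpq hpq (abs_nonneg _) hr
    have h5 : 2 * q * |p - q| ≤ 2 * K * r :=
      mul_le_mul (by linarith) hpq (abs_nonneg _) (by linarith)
    linarith
  rw [h1]
  refine (abs_add_le _ _).trans (add_le_add ?_ ?_)
  · rw [abs_mul, abs_of_nonneg (by positivity : 0 ≤ (8 * u)⁻¹)]
    exact mul_le_mul (inv_anti₀ (by positivity) (by linarith)) h2 (abs_nonneg _) (by positivity)
  · rw [abs_mul, abs_of_nonneg (by positivity : 0 ≤ q ^ 2 / (8 * (u * f))), abs_sub_comm]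
    refine mul_le_mul_of_nonneg_right ?_ (abs_nonneg _)
    have h4 : c ^ 2 ≤ u * f := by
      rw [sq]; exact mul_le_mul hu hf hc.le hu0.le
    exact div_le_div₀ (by positivity) (pow_le_pow_left₀ hq hqK 2) (by positivity) (by linarith)

variable [AddAction (Eucl d) Ω] [MeasurableVAdd₂ (Eucl d) Ω] [VAddInvariantMeasure (Eucl d) Ω μ]

lemma measurable_weakGrad (f : Ω → ℝ) : Measurable (weakGrad (d := d) μ f) :=
  (WithLp.measurable_toLp 2 _).comp
    (measurable_pi_lambda _ fun j => measurable_weakPartial j f)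

lemma memLp_weakGrad {p : ℝ≥0∞} {f : Ω → ℝ} (h : ∀ i : Fin d, MemLp (weakPartial μ i f) p μ) :
    MemLp (weakGrad (d := d) μ f) p μ :=
  MemLp.of_eval_piLp h

lemma integrable_density {V : Ω → ℝ} (hV : Integrable V μ) {f : Ω → ℝ} (hf : f ∈ Fw d μ) :
    Integrable (fun ω => ‖weakGrad (d := d) μ f ω‖ ^ 2 / (8 * f ω) + V ω * f ω) μ := by
  obtain ⟨⟨hfm, -, -⟩, -, ⟨c, hc, hcf⟩, hfb, hfwb⟩ := hf
  obtain ⟨C, hC⟩ := exists_ae_norm_le hfb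
  obtain ⟨K, hK⟩ := exists_ae_norm_le (memLp_weakGrad hfwb)
  have hm := measurable_weakGrad (d := d) (μ := μ) f
  refine Integrable.add ?_ (hV.mul_bdd hfm.aestronglyMeasurable hC)
  refine Integrable.of_bound
    ((hm.norm.pow_const 2).div (hfm.const_mul 8)).aestronglyMeasurable (K ^ 2 / (8 * c)) ?_
  filter_upwards [hcf, hK] with ω h1 h2
  have : 0 < f ω := hc.trans h1
  rw [Real.norm_of_nonneg (by positivity)]
  exact div_le_div₀ (by positivity) (pow_le_pow_left₀ (norm_nonneg _) h2 2) (by positivity)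
    (by linarith)

lemma densityEnergy_nonneg {V : Ω → ℝ} (hV : ∀ ω, 0 ≤ V ω) {f : Ω → ℝ} (hf : f ∈ Fw d μ) :
    0 ≤ densityEnergy μ (weakGrad (d := d) μ) V f := by
  obtain ⟨c, hc, hcf⟩ := hf.2.2.1
  refine integral_nonneg_of_ae ?_
  filter_upwards [hcf] with ω hω
  have h0 : 0 < f ω := hc.trans hω
  have h1 := hV ω
  show 0 ≤ ‖weakGrad (d := d) μ f ω‖ ^ 2 / (8 * f ω) + V ω * f ω
  positivity

lemma norm_sq_weakGrad_sub {u f : Ω → ℝ} (hu : u ∈ Dw d μ) (hf : f ∈ Dw d μ) :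
    ∀ᵐ ω ∂μ, ‖weakGrad (d := d) μ u ω - weakGrad μ f ω‖ ^ 2 =
      ∑ i : Fin d, weakPartial μ i (u - f) ω ^ 2 := by
  have h : ∀ᵐ ω ∂μ, ∀ i : Fin d, weakPartial μ i (u - f) ω =
      (weakPartial μ i u - weakPartial μ i f) ω :=
    ae_all_iff.2 fun i => weakPartial_sub (hu.2.2 i).1 (hf.2.2 i).1
  filter_upwards [h] with ω hω
  rw [EuclideanSpace.norm_sq_eq]
  refine Finset.sum_congr rfl fun i _ => ?_
  rw [hω i, Real.norm_eq_abs, sq_abs]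
  rfl

lemma memLp_weakPartial_sub {u f : Ω → ℝ} (hu : u ∈ Dw d μ) (hf : f ∈ Dw d μ) (i : Fin d) :
    MemLp (weakPartial μ i (u - f)) 2 μ :=
  (memLp_congr_ae (weakPartial_sub (hu.2.2 i).1 (hf.2.2 i).1)).2 ((hu.2.2 i).2.sub (hf.2.2 i).2)

/-- The density energy is continuous along sequences which converge in `‖·‖_∇` and are uniformly
bounded away from zero. -/
lemma tendsto_densityEnergy {V : Ω → ℝ} (hV : MemLp V 2 μ) {u : ℕ → Ω → ℝ} {f : Ω → ℝ}
    (hu : ∀ n, u n ∈ Fw d μ) (hf : f ∈ Fw d μ) {c : ℝ} (hc : 0 < c)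
    (huc : ∀ n, ∀ᵐ ω ∂μ, c ≤ u n ω) (hfc : ∀ᵐ ω ∂μ, c ≤ f ω)
    (ht : Tendsto (fun n => nablaNorm d μ (u n - f)) atTop (𝓝 0)) :
    Tendsto (fun n => densityEnergy μ (weakGrad (d := d) μ) V (u n)) atTop
      (𝓝 (densityEnergy μ (weakGrad (d := d) μ) V f)) := by
  obtain ⟨K, hK⟩ := exists_ae_norm_le (memLp_weakGrad hf.2.2.2.2)
  have hL : ∀ n, MemLp (u n - f) 2 μ := fun n => (hu n).1.2.1.sub hf.1.2.1
  have hVi := hV.integrable one_le_two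
  have hD : Tendsto (fun n => ∫ ω, (u n - f) ω ^ 2 ∂μ) atTop (𝓝 0) :=
    tendsto_integral_sq hL (tendsto_of_tendsto_of_tendsto_of_le_of_le tendsto_const_nhds ht
      (fun _ => zero_le) fun n => le_self_add)
  have hP : ∀ i : Fin d, Tendsto (fun n => ∫ ω, weakPartial μ i (u n - f) ω ^ 2 ∂μ) atTop
      (𝓝 0) := by
    intro i
    refine tendsto_integral_sq (fun n => memLp_weakPartial_sub (hu n).1 hf.1 i)
      (tendsto_of_tendsto_of_tendsto_of_le_of_le tendsto_const_nhds ht (fun _ => zero_le)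
        fun n => ?_)
    refine le_trans ?_ le_add_self
    exact Finset.single_le_sum (f := fun i => eLpNorm (weakPartial μ i (u n - f)) 2 μ)
      (fun _ _ => zero_le) (Finset.mem_univ i)
  set r : ℕ → Ω → ℝ := fun n ω => ‖weakGrad (d := d) μ (u n) ω - weakGrad μ f ω‖ with hr
  have hrL : ∀ n, MemLp (r n) 2 μ := fun n =>
    ((memLp_weakGrad fun i => ((hu n).1.2.2 i).2).sub
      (memLp_weakGrad fun i => (hf.1.2.2 i).2)).norm
  have hR : Tendsto (fun n => ∫ ω, r n ω ^ 2 ∂μ) atTop (𝓝 0) := by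
    have h1 : ∀ n, ∫ ω, r n ω ^ 2 ∂μ = ∑ i : Fin d, ∫ ω, weakPartial μ i (u n - f) ω ^ 2 ∂μ := by
      intro n
      rw [integral_congr_ae (norm_sq_weakGrad_sub (hu n).1 hf.1), integral_finsetSum]
      exact fun i _ => (memLp_weakPartial_sub (hu n).1 hf.1 i).integrable_sq
    simp only [h1]
    simpa using tendsto_finsetSum Finset.univ fun i _ => hP i
  have hsqrt : ∀ {x : ℕ → ℝ}, Tendsto x atTop (𝓝 0) →
      Tendsto (fun n => Real.sqrt (x n)) atTop (𝓝 0) := by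
    intro x hx
    simpa [Function.comp_def] using (Real.continuous_sqrt.tendsto 0).comp hx
  rw [tendsto_iff_norm_sub_tendsto_zero]
  -- The first two terms integrate `abs_div_sub_div_le`, with `L¹` norms bounded by `L²` norms. The
  -- last is the Cauchy-Schwarz bound for `E[V |u_n - f|]`, where `V ∈ L²` enters.
  have hlim : Tendsto (fun n => (8 * c)⁻¹ * (∫ ω, r n ω ^ 2 ∂μ +
      2 * |K| * Real.sqrt (∫ ω, r n ω ^ 2 ∂μ)) +
      |K| ^ 2 / (8 * c ^ 2) * Real.sqrt (∫ ω, (u n - f) ω ^ 2 ∂μ) +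
      Real.sqrt (∫ ω, V ω ^ 2 ∂μ) * Real.sqrt (∫ ω, (u n - f) ω ^ 2 ∂μ)) atTop (𝓝 0) := by
    have := (((hR.add ((hsqrt hR).const_mul (2 * |K|))).const_mul (8 * c)⁻¹).add
      ((hsqrt hD).const_mul (|K| ^ 2 / (8 * c ^ 2)))).add
      ((hsqrt hD).const_mul (Real.sqrt (∫ ω, V ω ^ 2 ∂μ)))
    simpa using this
  refine squeeze_zero (fun n => norm_nonneg _) (fun n => ?_) hlim
  have hri := (hrL n).integrable one_le_two
  have hdi := ((hL n).integrable one_le_two).abs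
  have hr2 := (hrL n).integrable_sq
  have hVd : Integrable (fun ω => |V ω| * |(u n - f) ω|) μ :=
    integrable_mul_of_memLp_two hV.norm (hL n).norm
  have hI1 : Integrable (fun ω => (8 * c)⁻¹ * (r n ω ^ 2 + 2 * |K| * r n ω)) μ :=
    (hr2.add (hri.const_mul _)).const_mul _
  have hI2 : Integrable (fun ω => |K| ^ 2 / (8 * c ^ 2) * |(u n - f) ω|) μ := hdi.const_mul _
  have hI3 : Integrable (fun ω => (8 * c)⁻¹ * (r n ω ^ 2 + 2 * |K| * r n ω) +
      |K| ^ 2 / (8 * c ^ 2) * |(u n - f) ω|) μ := hI1.add hI2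
  rw [densityEnergy, densityEnergy, ← integral_sub (integrable_density hVi (hu n))
    (integrable_density hVi hf)]
  refine (norm_integral_le_of_norm_le (g := fun ω => (8 * c)⁻¹ * (r n ω ^ 2 + 2 * |K| * r n ω) +
    |K| ^ 2 / (8 * c ^ 2) * |(u n - f) ω| + |V ω| * |(u n - f) ω|) (hI3.add hVd) ?_).trans ?_
  · filter_upwards [huc n, hfc, hK] with ω h1 h2 h3
    have h4 := abs_div_sub_div_le (K := |K|) (r := r n ω) hc h1 h2
      (p := ‖weakGrad (d := d) μ (u n) ω‖) (norm_nonneg (weakGrad (d := d) μ f ω))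
      (h3.trans (le_abs_self K)) (abs_norm_sub_norm_le _ _)
    have h5 : ‖weakGrad (d := d) μ (u n) ω‖ ^ 2 / (8 * u n ω) + V ω * u n ω -
        (‖weakGrad (d := d) μ f ω‖ ^ 2 / (8 * f ω) + V ω * f ω) =
        (‖weakGrad (d := d) μ (u n) ω‖ ^ 2 / (8 * u n ω) -
          ‖weakGrad (d := d) μ f ω‖ ^ 2 / (8 * f ω)) + V ω * (u n - f) ω := by
      rw [Pi.sub_apply]; ring
    rw [h5]
    refine (norm_add_le _ _).trans (add_le_add h4 ?_)
    rw [norm_mul]; rfl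
  · rw [integral_add hI3 hVd, integral_add hI1 hI2, integral_const_mul, integral_const_mul,
      integral_add hr2 (hri.const_mul _), integral_const_mul]
    have h1 : ∫ ω, r n ω ∂μ ≤ Real.sqrt (∫ ω, r n ω ^ 2 ∂μ) := by
      refine le_trans (integral_mono hri hri.abs fun ω => le_abs_self _)
        (integral_abs_le_sqrt (hrL n))
    have h2 := integral_abs_le_sqrt (hL n)
    have h3 := integral_abs_mul_le_sqrt hV (hL n)
    gcongr

end Density

/-! ### Independence of the variational value from the chosen sets. -/

section Main

variable {μ : Measure Ω} [IsProbabilityMeasure μ]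
variable [AddAction (Eucl d) Ω] [MeasurableVAdd₂ (Eucl d) Ω] [VAddInvariantMeasure (Eucl d) Ω μ]

/-- The value is independent of the dense set of divergence-free fields. -/
lemma variationalValue_congr_phi (grad : (Ω → ℝ) → Ω → Eucl d) (V : Ω → ℝ) {F : Set (Ω → ℝ)}
    (hF : F ⊆ Fw d μ) {y : Eucl d} {Φ Φ' : Set (Ω → Eucl d)} (hΦ : Φ ∈ AdmissiblePhi μ y)
    (hΦ' : Φ' ∈ AdmissiblePhi μ y) :
    variationalValue μ grad V F Φ = variationalValue μ grad V F Φ' := by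
  rw [variationalValue_eq, variationalValue_eq]
  congr 1
  refine iInf_congr fun f => ?_
  obtain ⟨c, hc, hcf⟩ := (hF f.2).2.2.1
  have hcf' : ∀ᵐ ω ∂μ, c ≤ f.1 ω := hcf.mono fun ω h => h.le
  have hm := (hF f.2).1.1
  rw [ciInf_fluxEnergy_eq hm hc hcf' hΦ, ciInf_fluxEnergy_eq hm hc hcf' hΦ']

lemma one_mem_Fs : (fun _ => 1) ∈ Fs (Ω := Ω) d μ :=
  ⟨measurable_const, integrable_const 1, SmoothBounded.of_realisation_const (C := 1)
    (fun _ => by simp) (fun _ _ => rfl), by simp, 1, one_pos, fun _ => le_rfl⟩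

lemma bddBelow_sqrt {ι : Type*} (g : ι → ℝ) : BddBelow (Set.range fun i => Real.sqrt (g i)) := by
  refine ⟨0, ?_⟩
  rintro _ ⟨i, rfl⟩
  exact Real.sqrt_nonneg _

/-- The value is independent of the approximating set of densities. -/
lemma variationalValue_eq_Fw {V : Ω → ℝ} (hV0 : ∀ ω, 0 ≤ V ω) (hV : MemLp V 2 μ)
    {F : Set (Ω → ℝ)} (hF : F ∈ AdmissibleF d μ) (y : Eucl d) :
    variationalValue μ (weakGrad μ) V F (PhiS μ y) =
      variationalValue μ (weakGrad μ) V (Fw d μ) (PhiS μ y) := by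
  rw [variationalValue_eq, variationalValue_eq]
  congr 1
  have h1 : (fun _ => 1) ∈ Fw (Ω := Ω) d μ := Fs_subset_Fw one_mem_Fs
  have : Nonempty (Fw (Ω := Ω) d μ) := ⟨⟨_, h1⟩⟩
  have : Nonempty F := by
    obtain ⟨u, -, hu, -⟩ := hF.2 _ h1
    exact ⟨⟨u 0, hu 0⟩⟩
  have : Nonempty (PhiS (Ω := Ω) μ y) := ⟨⟨_, const_mem_PhiS y⟩⟩
  refine le_antisymm (le_ciInf fun f => ?_) (le_ciInf fun f =>
    ciInf_le (bddBelow_sqrt _) (⟨f.1, hF.1 f.2⟩ : Fw (Ω := Ω) d μ))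
  obtain ⟨f, hf⟩ := f
  obtain ⟨u, c₁, huF, hc₁, ht, huc₁⟩ := hF.2 f hf
  obtain ⟨c₂, hc₂, hfc₂⟩ := hf.2.2.1
  set c := min c₁ c₂ with hc
  have hc0 : 0 < c := lt_min hc₁ hc₂
  have huW := fun n => hF.1 (huF n)
  have huc : ∀ n, ∀ᵐ ω ∂μ, c ≤ u n ω := fun n =>
    huc₁.mono fun ω h => (min_le_left _ _).trans (h n).le
  have hfc : ∀ᵐ ω ∂μ, c ≤ f ω := hfc₂.mono fun ω h => (min_le_right _ _).trans h.le
  have hA := tendsto_densityEnergy hV huW hf hc0 huc hfc ht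
  have hL : ∀ n, MemLp (u n - f) 2 μ := fun n => (huW n).1.2.1.sub hf.1.2.1
  have hD : Tendsto (fun n => ∫ ω, (u n - f) ω ^ 2 ∂μ) atTop (𝓝 0) :=
    tendsto_integral_sq hL (tendsto_of_tendsto_of_tendsto_of_le_of_le tendsto_const_nhds ht
      (fun _ => zero_le) fun n => le_self_add)
  rw [Real.mul_iInf_of_nonneg (densityEnergy_nonneg hV0 hf)]
  set J := ⨅ f : F, Real.sqrt (densityEnergy μ (weakGrad (d := d) μ) V f.1 *
    ⨅ φ : PhiS μ y, fluxEnergy μ f.1 φ.1) with hJ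
  -- Fixing one smooth, hence bounded, field reduces the claim to the limit of a product of two
  -- convergent energies. Only an upper bound for the inner infimum at `u_n` is needed, and the same
  -- field supplies it.
  refine Real.le_sqrt_of_sq_le (le_ciInf fun φ => ?_)
  obtain ⟨φ, hφ⟩ := φ
  obtain ⟨K, hK⟩ := hφ.2.2.1.exists_norm_le
  have hB := tendsto_fluxEnergy (fun n => (huW n).1.1) hf.1.1 hc0 huc hfc hL hD hφ.1 hK
  refine ge_of_tendsto' (hA.mul hB) fun n => ?_
  have hA0 := densityEnergy_nonneg (d := d) hV0 (huW n)
  have hB0 := ciInf_fluxEnergy_nonneg hc0 (huc n) (PhiS μ y)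
  have hJ0 : 0 ≤ J := Real.iInf_nonneg fun _ => Real.sqrt_nonneg _
  have hJn : J ≤ Real.sqrt (densityEnergy μ (weakGrad (d := d) μ) V (u n) *
      ⨅ φ : PhiS μ y, fluxEnergy μ (u n) φ.1) :=
    ciInf_le (bddBelow_sqrt _) (⟨u n, huF n⟩ : F)
  calc J ^ 2 ≤ densityEnergy μ (weakGrad (d := d) μ) V (u n) * ⨅ φ : PhiS μ y, fluxEnergy μ (u n) φ.1 :=
        (Real.le_sqrt hJ0 (mul_nonneg hA0 hB0)).1 hJn
    _ ≤ _ := mul_le_mul_of_nonneg_left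
        (ciInf_le (bddBelow_fluxEnergy hc0 (huc n) _) (⟨φ, hφ⟩ : PhiS (Ω := Ω) μ y)) hA0

/-- The two gradients agree almost surely on `Fs`, so the whole comparison of densities can be made
with the weak gradient. -/
lemma variationalValue_classicalGrad (V : Ω → ℝ) (Φ : Set (Ω → Eucl d)) :
    variationalValue μ classicalGrad V (Fs d μ) Φ =
      variationalValue μ (weakGrad μ) V (Fs d μ) Φ := by
  rw [variationalValue_eq, variationalValue_eq]
  congr 1
  refine iInf_congr fun f => ?_
  have : densityEnergy μ (classicalGrad (d := d)) V f.1 = densityEnergy μ (weakGrad (d := d) μ) V f.1 := by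
    refine integral_congr_ae ?_
    filter_upwards [f.2.2.2.1.weakGrad_ae_eq (μ := μ) f.2.1] with ω hω
    rw [hω]
  rw [this]

end Main

end StationaryVar

open StationaryVar in
theorem proposition2p2 {d : ℕ} (hd : 1 ≤ d) {Ω : Type*} [MeasurableSpace Ω]
    [AddAction (Eucl d) Ω] [MeasurableVAdd₂ (Eucl d) Ω]
    (μ : Measure Ω) [IsProbabilityMeasure μ] [VAddInvariantMeasure (Eucl d) Ω μ]
    (V : Ω → ℝ) (hV : IsPotential d μ V) (y : Eucl d) :
    (∀ Φ ∈ AdmissiblePhi μ y,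
      variationalValue μ classicalGrad V (Fs d μ) Φ = Gam μ V y) ∧
    (MemLp V 2 μ → ∀ F ∈ AdmissibleF d μ, ∀ Φ ∈ AdmissiblePhi μ y,
      variationalValue μ (weakGrad μ) V F Φ = Gam μ V y) := by
  refine ⟨fun Φ hΦ => ?_, fun hV2 F hF Φ hΦ => ?_⟩
  · exact variationalValue_congr_phi _ _ Fs_subset_Fw hΦ (PhiS_mem_admissiblePhi y)
  -- The densities are exchanged through `Fw` while the fields are still `PhiS`, because continuity
  -- in the density uses their boundedness; only then is `PhiS` replaced by `Φ`.
  · rw [Gam, variationalValue_classicalGrad, variationalValue_eq_Fw hV.nonneg hV2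
      Fs_mem_admissibleF, ← variationalValue_eq_Fw hV.nonneg hV2 hF]
    exact variationalValue_congr_phi _ _ hF.1 hΦ (PhiS_mem_admissiblePhi y)
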